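/- **Setting.** Let $X,Y$ be Banach spaces and let $A$, $B$ generate exponentially stable $C_0$-semigroups $(e^{tA})_{t\ge 0}$ on $X$ and $(e^{tB})_{t\ge 0}$ on $Y$. Let $X_1=D(A)$ and $Y_1=D(B)$ with the norms $\|x\|_{X_1}=\|Ax\|_X$, $\|y\|_{Y_1}=\|By\|_Y$. Let $\gamma,\delta\in(0,1]$ and let $X_\gamma$, $Y_\delta$ be Banach spaces with continuous embeddings $X_1\hookrightarrow X_\gamma\hookrightarrow X$ and $Y_1\hookrightarrow Y_\delta\hookrightarrow Y$ (for instance the interpolation spaces of order $\gamma$, $\delta$). Let $f:X_1\times Y_1\to X_\gamma$ be of class $C^2$ and $g:X_1\times Y_1\to Y_\delta$ of class $C^1$, with $f(0,0)=0$, $g(0,0)=0$, and let $(u^0,v^0)\in X_1\times Y_1$ satisfy $f(u^0,v^0)=0$. Put $$\tilde f(u,v)=f(u,v)-\mathrm D_xf(u^0,v^0)u,\qquad \tilde A_\varepsilon=\varepsilon A+\mathrm D_xf(u^0,v^0),\quad D(\tilde A_\varepsilon)=X_1 .$$ Assume that there are $L_{\tilde f},L_g\ge 0$ such that, for all $x_i\in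 X_1$, $y_i\in Y_1$, $$\|\tilde f(x_1,y_1)-\tilde f(x_2,y_2)\|_{X_\gamma}\le L_{\tilde f}(\|x_1-x_2\|_{X_1}+\|y_1-y_2\|_{Y_1}),$$ $$\|g(x_1,y_1)-g(x_2,y_2)\|_{Y_\delta}\le L_g(\|x_1-x_2\|_{X_1}+\|y_1-y_2\|_{Y_1}).$$ Let $\varepsilon,\zeta>0$ with $\varepsilon\zeta^{-1}<1$ be small enough that the following hold, with $\omega_A\in\mathbb R$, $\lambda_0<0$, $M_A,C_A,M_B,C_B>0$, $0\le N_F^\zeta<N_S^\zeta$ and $\mu:=\varepsilon\omega_A+\lambda_0$. 1. $\mu<0$, and $\tilde A_\varepsilon$ generates a $C_0$-semigroup on $X$ with $\|e^{t\tilde A_\varepsilon}\|_{\mathcal B(X_1)}\le M_Ae^{\mu t}$ and $\|e^{t\tilde A_\varepsilon}\|_{\mathcal B(X_\gamma,X_1)}\le C_At^{\gamma-1}e^{\mu t}$ for $t>0$. 2. $Y=Y_F^\zeta\oplus Y_S^\zeta$ with closed subspaces, $Y_S^\zeta\ne\{0\}$. The projections commute with $B$ on $Y_1$, and $\mathrm{pr}_{Y_S^\zeta}$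 maps $Y_\delta$ boundedly into $Y_1$. There is a $C_0$-group $(e^{tB})_{t\in\mathbb R}$ on $Y_S^\zeta$ that agrees with the given semigroup for $t\ge 0$. For $y_F\in Y_F^\zeta\cap Y_\delta$ and $y_S\in Y_S^\zeta\cap Y_1$, $$\|e^{tB}y_F\|_{Y_1}\le C_Bt^{\delta-1}e^{(N_F^\zeta+\zeta^{-1}\mu)t}\|y_F\|_{Y_\delta}\ (t>0),\qquad \|e^{-tB}y_S\|_{Y_1}\le M_Be^{-(N_S^\zeta+\zeta^{-1}\mu)t}\|y_S\|_{Y_1}\ (t\ge0).$$ 3. With $n_F=\|\mathrm{pr}_{Y_F^\zeta}\|_{\mathcal B(Y_\delta)}$ and $n_S=\|\mathrm{pr}_{Y_S^\zeta}\|_{\mathcal B(Y_\delta,Y_1)}$, $$\frac{2^\gamma L_{\tilde f}C_A\Gamma(\gamma)}{\big(2(\varepsilon\zeta^{-1}-1)\mu+\varepsilon(N_S^\zeta+N_F^\zeta)\big)^\gamma}+\frac{2^\delta L_gn_FC_B\Gamma(\delta)}{(N_S^\zeta-N_F^\zeta)^\delta}+\frac{2L_gn_SM_B\Gamma(\delta)}{N_S^\zeta-N_F^\zeta}<1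 .$$ **The slow manifold.** Let $\eta=\zeta^{-1}\mu+\tfrac12(N_S^\zeta+N_F^\zeta)$ and let $C_\eta$ be the space of continuous $(u,v_F,v_S):(-\infty,0]\to X_1\times(Y_F^\zeta\cap Y_1)\times(Y_S^\zeta\cap Y_1)$ with $\sup_{t\le0}e^{-\eta t}(\|u(t)\|_{X_1}+\|v_F(t)\|_{Y_1}+\|v_S(t)\|_{Y_1})<\infty$. For $y_0\in Y_S^\zeta\cap Y_1$ consider the fixed point equations, for $t\le0$, $$u(t)=\tfrac1\varepsilon\int_{-\infty}^te^{\varepsilon^{-1}(t-s)\tilde A_\varepsilon}\tilde f(u,v_F+v_S)\,ds,\qquad v_F(t)=\int_{-\infty}^te^{(t-s)B}\mathrm{pr}_{Y_F^\zeta}g(u,v_F+v_S)\,ds,$$ $$v_S(t)=e^{tB}y_0+\int_0^te^{(t-s)B}\mathrm{pr}_{Y_S^\zeta}g(u,v_F+v_S)\,ds .$$ **Proposition.** For every $y_0\in Y_S^\zeta\cap Y_1$ these equations have a unique solution in $C_\eta$, so that $h^{\varepsilon,\zeta}(y_0)=(h^{\varepsilon,\zeta}_{X_1}(y_0),h^{\varepsilon,\zeta}_{Y_F^\zeta}(y_0)):=(u(0),v_F(0))$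 is well defined. There are constants $C,c>0$ such that for every $T\ge 0$, every strict solution $(u^\varepsilon,v_F^\varepsilon,v_S^\varepsilon)\in C([0,T];X_1\times Y_1\times Y_1)\cap C^1([0,T];X\times Y\times Y)$, with $v_F^\varepsilon\in Y_F^\zeta$ and $v_S^\varepsilon\in Y_S^\zeta$, of $$\partial_tu^\varepsilon=Au^\varepsilon+\tfrac1\varepsilon f(u^\varepsilon,v_F^\varepsilon+v_S^\varepsilon),\quad \partial_tv_F^\varepsilon=Bv_F^\varepsilon+\mathrm{pr}_{Y_F^\zeta}g(u^\varepsilon,v_F^\varepsilon+v_S^\varepsilon),\quad \partial_tv_S^\varepsilon=Bv_S^\varepsilon+\mathrm{pr}_{Y_S^\zeta}g(u^\varepsilon,v_F^\varepsilon+v_S^\varepsilon),$$ and every $t\in[0,T]$, $$\|u^\varepsilon(t)-h^{\varepsilon,\zeta}_{X_1}(v_S^\varepsilon(t))\|_{X_1}+\|v_F^\varepsilon(t)-h^{\varepsilon,\zeta}_{Y_F^\zeta}(v_S^\varepsilon(t))\|_{Y_1}\le Ce^{-ct}\Big(\|u^\varepsilon(0)-h^{\varepsilon,\zeta}_{X_1}(v_S^\varepsilon(0))\|_{X_1}+\|v_F^\varepsilon(0)-h^{\varepsilon,\zeta}_{Y_F^\zeta}(v_S^\varepsilon(0))\|_{Y_1}\Big).$$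 -/

import Mathlib

open Filter Topology Set MeasureTheory

namespace FastReaction

/-- A strongly continuous semigroup of bounded operators on a Banach space.
Only the values at times `t ≥ 0` are meaningful. -/
structure C0Semigroup (X : Type*) [NormedAddCommGroup X] [NormedSpace ℝ X] where
  op : ℝ → X →L[ℝ] X
  op_zero : op 0 = ContinuousLinearMap.id ℝ X
  op_add : ∀ s t : ℝ, 0 ≤ s → 0 ≤ t → op (s + t) = (op s).comp (op t)
  strongly_continuous : ∀ x : X, Tendsto (fun t => op t x) (𝓝[>] 0) (𝓝 x)

/-- A strongly continuous group of bounded operators. -/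
structure C0Group (X : Type*) [NormedAddCommGroup X] [NormedSpace ℝ X] where
  op : ℝ → X →L[ℝ] X
  op_zero : op 0 = ContinuousLinearMap.id ℝ X
  op_add : ∀ s t : ℝ, op (s + t) = (op s).comp (op t)
  strongly_continuous : ∀ x : X, Tendsto (fun t => op t x) (𝓝 0) (𝓝 x)

/-- The infinitesimal generator of `S` is the operator with domain `range ι` (where `ι` is
injective) that maps `ι z` to `A z`: the limit of `(S t x - x) / t` as `t → 0+` exists exactly for
`x` in the range of `ι`, and it is `A z` for `x = ι z`. -/
def IsGenerator {X X₁ : Type*} [NormedAddCommGroup X] [NormedSpace ℝ X]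
    [NormedAddCommGroup X₁] [NormedSpace ℝ X₁]
    (S : C0Semigroup X) (ι A : X₁ →L[ℝ] X) : Prop :=
  Function.Injective ι ∧
    ∀ x y : X, Tendsto (fun t : ℝ => t⁻¹ • (S.op t x - x)) (𝓝[>] 0) (𝓝 y) ↔
      ∃ z : X₁, ι z = x ∧ A z = y

/-- A Banach space `X` with an exponentially stable `C₀`-semigroup, the domain `X₁` of its
generator `A`, normed by `‖x‖_{X₁} = ‖A x‖_X`, and a Banach space `Xγ` between them, with
continuous embeddings `X₁ ⊆ Xγ ⊆ X` (for instance `X₁` itself, or any interpolation space). -/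
structure Scale (X X₁ Xγ : Type*)
    [NormedAddCommGroup X] [NormedSpace ℝ X] [NormedAddCommGroup X₁] [NormedSpace ℝ X₁]
    [NormedAddCommGroup Xγ] [NormedSpace ℝ Xγ] where
  semigroup : C0Semigroup X
  /-- the embedding of `X₁` into `X` -/
  ι₁ : X₁ →L[ℝ] X
  /-- the generator, as a map from its domain `X₁` to `X` -/
  gen : X₁ →L[ℝ] X
  /-- the embedding of `Xγ` into `X` -/
  ι : Xγ →L[ℝ] X
  /-- the embedding of `X₁` into `Xγ` -/
  κ : X₁ →L[ℝ] Xγ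
  isGenerator : IsGenerator semigroup ι₁ gen
  norm_gen : ∀ x, ‖gen x‖ = ‖x‖
  exp_stable : ∃ M ω : ℝ, 0 < ω ∧ ∀ t, 0 ≤ t → ‖semigroup.op t‖ ≤ M * Real.exp (-ω * t)
  ι_injective : Function.Injective ι
  ι_κ : ∀ x, ι (κ x) = ι₁ x

/-- The data of the fast-reaction system
`∂ₜ u = A u + ε⁻¹ f(u, v)`, `∂ₜ v = B v + g(u, v)`, where `A = spX.gen` and `B = spY.gen`,
and a point `(u⁰, v⁰)` of its critical manifold. -/
structure System (X X₁ Xγ Y Y₁ Yδ : Type*)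
    [NormedAddCommGroup X] [NormedSpace ℝ X] [NormedAddCommGroup X₁] [NormedSpace ℝ X₁]
    [NormedAddCommGroup Xγ] [NormedSpace ℝ Xγ]
    [NormedAddCommGroup Y] [NormedSpace ℝ Y] [NormedAddCommGroup Y₁] [NormedSpace ℝ Y₁]
    [NormedAddCommGroup Yδ] [NormedSpace ℝ Yδ] where
  spX : Scale X X₁ Xγ
  spY : Scale Y Y₁ Yδ
  f : X₁ × Y₁ → Xγ
  g : X₁ × Y₁ → Yδ
  f_contDiff : ContDiff ℝ 2 f
  g_contDiff : ContDiff ℝ 1 g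
  f_zero : f (0, 0) = 0
  g_zero : g (0, 0) = 0
  u₀ : X₁
  v₀ : Y₁
  critical : f (u₀, v₀) = 0

section

variable {X X₁ Xγ Y Y₁ Yδ : Type*}
  [NormedAddCommGroup X] [NormedSpace ℝ X] [NormedAddCommGroup X₁] [NormedSpace ℝ X₁]
  [NormedAddCommGroup Xγ] [NormedSpace ℝ Xγ]
  [NormedAddCommGroup Y] [NormedSpace ℝ Y] [NormedAddCommGroup Y₁] [NormedSpace ℝ Y₁]
  [NormedAddCommGroup Yδ] [NormedSpace ℝ Yδ]

/-- The partial derivative `D_x f(u⁰, v⁰)`. -/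
noncomputable def System.Dxf (S : System X X₁ Xγ Y Y₁ Yδ) : X₁ →L[ℝ] Xγ :=
  fderiv ℝ (fun x => S.f (x, S.v₀)) S.u₀

/-- The modified nonlinearity `f̃(u, v) = f(u, v) - D_x f(u⁰, v⁰) u`. -/
noncomputable def System.fMod (S : System X X₁ Xγ Y Y₁ Yδ) (p : X₁ × Y₁) : Xγ :=
  S.f p - S.Dxf p.1

/-- The modified operator `Ã_ε = ε A + D_x f(u⁰, v⁰)`, with domain `X₁`. -/
noncomputable def System.genMod (S : System X X₁ Xγ Y Y₁ Yδ) (ε : ℝ) : X₁ →L[ℝ] X :=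
  ε • S.spX.gen + S.spX.ι.comp S.Dxf

/-- `Ã_ε` generates a `C₀`-semigroup on `X` with
`‖e^{tÃ_ε}‖_{B(X₁)} ≤ M e^{μt}` and `‖e^{tÃ_ε}‖_{B(Xγ, X₁)} ≤ C t^{γ-1} e^{μt}`. -/
structure ModifiedSemigroup (S : System X X₁ Xγ Y Y₁ Yδ) (ε γ μ M C : ℝ) where
  semigroup : C0Semigroup X
  isGenerator : IsGenerator semigroup S.spX.ι₁ (S.genMod ε)
  bound_one : ∀ t, 0 ≤ t → ∀ x : X₁, ∃ y : X₁,
    S.spX.ι₁ y = semigroup.op t (S.spX.ι₁ x) ∧ ‖y‖ ≤ M * Real.exp (μ * t) * ‖x‖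
  bound_smoothing : ∀ t, 0 < t → ∀ x : Xγ, ∃ y : X₁,
    S.spX.ι₁ y = semigroup.op t (S.spX.ι x) ∧
      ‖y‖ ≤ C * t ^ (γ - 1) * Real.exp (μ * t) * ‖x‖

/-- A splitting `Y = Y_F ⊕ Y_S` into closed subspaces, given by the bounded projection `P` onto
`Y_S = range P` along `Y_F = ker P`. The projection commutes with `B`, it maps `Yδ` boundedly into
`Y₁`, the part of `B` in `Y_S` generates a `C₀`-group that extends `e^{tB}`, and, with
`βF = N_F + ζ⁻¹(εω_A + λ₀)` and `βS = N_S + ζ⁻¹(εω_A + λ₀)`,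
`‖e^{tB} y_F‖_{Y₁} ≤ C_B t^{δ-1} e^{βF t} ‖y_F‖_{Yδ}` and
`‖e^{-tB} y_S‖_{Y₁} ≤ M_B e^{-βS t} ‖y_S‖_{Y₁}`. -/
structure Splitting (sp : Scale Y Y₁ Yδ) (δ βF βS CB MB : ℝ) where
  P : Y →L[ℝ] Y
  P_idem : ∀ y, P (P y) = P y
  P_comm : ∀ y : Y₁, ∃ y' : Y₁, sp.ι₁ y' = P (sp.ι₁ y) ∧ sp.gen y' = P (sp.gen y)
  /-- the projection onto `Y_S`, as a map from `Yδ` to `Y₁` -/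
  Q : Yδ →L[ℝ] Y₁
  ι₁_Q : ∀ y, sp.ι₁ (Q y) = P (sp.ι y)
  group : C0Group P.range
  group_eq : ∀ t, 0 ≤ t → ∀ y : P.range, (group.op t y : Y) = sp.semigroup.op t (y : Y)
  bound_fast : ∀ t, 0 < t → ∀ y : Yδ, P (sp.ι y) = 0 → ∃ y' : Y₁,
    sp.ι₁ y' = sp.semigroup.op t (sp.ι y) ∧
      ‖y'‖ ≤ CB * t ^ (δ - 1) * Real.exp (βF * t) * ‖y‖
  bound_slow : ∀ t, 0 ≤ t → ∀ (y : Y₁) (hy : sp.ι₁ y ∈ P.range), ∃ y' : Y₁,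
    sp.ι₁ y' = (group.op (-t) ⟨sp.ι₁ y, hy⟩ : Y) ∧
      ‖y'‖ ≤ MB * Real.exp (-βS * t) * ‖y‖

namespace Splitting

variable {sp : Scale Y Y₁ Yδ} {δ βF βS CB MB : ℝ}

/-- `y` belongs to `Y_S ∩ Y₁`. -/
def IsSlow (D : Splitting sp δ βF βS CB MB) (y : Y₁) : Prop := sp.ι₁ y ∈ D.P.range

/-- `y` belongs to `Y_F ∩ Y₁`. -/
def IsFast (D : Splitting sp δ βF βS CB MB) (y : Y₁) : Prop := D.P (sp.ι₁ y) = 0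

/-- The projection onto `Y_F`, on `Yδ`. -/
noncomputable def prF (D : Splitting sp δ βF βS CB MB) : Yδ →L[ℝ] Yδ :=
  ContinuousLinearMap.id ℝ Yδ - sp.κ.comp D.Q

/-- `e^{tB} pr_S y` for all real `t`, by means of the group on `Y_S`. -/
noncomputable def slowFlow (D : Splitting sp δ βF βS CB MB) (t : ℝ) (y : Y) : Y :=
  (D.group.op t ⟨D.P y, y, rfl⟩ : Y)

end Splitting

/-- The space `C_η`: continuous functions `w = (u, v_F, v_S)` on `(-∞, 0]` with values in
`X₁ × (Y_F ∩ Y₁) × (Y_S ∩ Y₁)` and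
`sup_{t ≤ 0} e^{-ηt} (‖u‖_{X₁} + ‖v_F‖_{Y₁} + ‖v_S‖_{Y₁}) < ∞`.
Values at positive times are irrelevant. -/
def weightedSpace (X₁ : Type*) [NormedAddCommGroup X₁] {sp : Scale Y Y₁ Yδ}
    {δ βF βS CB MB : ℝ}
    (D : Splitting sp δ βF βS CB MB) (η : ℝ) : Set (ℝ → X₁ × Y₁ × Y₁) :=
  {w | ContinuousOn w (Iic 0) ∧
    (∀ t ≤ 0, D.IsFast (w t).2.1 ∧ D.IsSlow (w t).2.2) ∧
    ∃ K : ℝ, ∀ t ≤ 0,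
      Real.exp (-η * t) * (‖(w t).1‖ + ‖(w t).2.1‖ + ‖(w t).2.2‖) ≤ K}

/-- `w = (u, v_F, v_S)` is, on `(-∞, 0]`, a fixed point of the Lyapunov–Perron operator with
base point `y₀ ∈ Y_S ∩ Y₁`:
`u(t) = ε⁻¹ ∫_{-∞}^t e^{ε⁻¹(t-s)Ã_ε} f̃(w(s)) ds`,
`v_F(t) = ∫_{-∞}^t e^{(t-s)B} pr_F g(w(s)) ds`,
`v_S(t) = e^{tB} y₀ + ∫_0^t e^{(t-s)B} pr_S g(w(s)) ds`.
The integrals are taken in `X` and in `Y`. -/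
def IsFixedPoint (S : System X X₁ Xγ Y Y₁ Yδ) {ε γ μ M C : ℝ}
    (E : ModifiedSemigroup S ε γ μ M C)
    {δ βF βS CB MB : ℝ} (D : Splitting S.spY δ βF βS CB MB) (y₀ : Y₁)
    (w : ℝ → X₁ × Y₁ × Y₁) : Prop :=
  ∀ t ≤ 0,
    S.spX.ι₁ (w t).1 =
      ε⁻¹ • ∫ s in Iic t, E.semigroup.op (ε⁻¹ * (t - s))
        (S.spX.ι (S.fMod ((w s).1, (w s).2.1 + (w s).2.2))) ∧
    S.spY.ι₁ (w t).2.1 =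
      ∫ s in Iic t, S.spY.semigroup.op (t - s)
        (S.spY.ι (D.prF (S.g ((w s).1, (w s).2.1 + (w s).2.2)))) ∧
    S.spY.ι₁ (w t).2.2 =
      D.slowFlow t (S.spY.ι₁ y₀) +
        ∫ s in (0 : ℝ)..t, D.slowFlow (t - s)
          (S.spY.ι (S.g ((w s).1, (w s).2.1 + (w s).2.2)))

/-- The map `h = (h_{X₁}, h_{Y_F}) : Y_S ∩ Y₁ → X₁ × (Y_F ∩ Y₁)` whose graph is the slow manifold:
the first two components at time `0` of the fixed point in `C_η` of the Lyapunov–Perron operator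
with the given base point. -/
noncomputable def slowMap (S : System X X₁ Xγ Y Y₁ Yδ) {ε γ μ M C : ℝ}
    (E : ModifiedSemigroup S ε γ μ M C)
    {δ βF βS CB MB : ℝ} (D : Splitting S.spY δ βF βS CB MB) (η : ℝ) (y₀ : Y₁) : X₁ × Y₁ :=
  let w := Classical.epsilon fun w : ℝ → X₁ × Y₁ × Y₁ =>
    w ∈ weightedSpace X₁ D η ∧ IsFixedPoint S E D y₀ w
  ((w 0).1, (w 0).2.1)

/-- `(u, v_F, v_S)` is a strict solution on `[0, T]` of the split fast-reaction system
`∂ₜ u = A u + ε⁻¹ f(u, v_F + v_S)`, `∂ₜ v_F = B v_F + pr_F g(u, v_F + v_S)`,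
`∂ₜ v_S = B v_S + pr_S g(u, v_F + v_S)`: it is continuous with values in `X₁ × Y₁ × Y₁`, and
differentiable with values in `X × Y × Y` (the derivative is then continuous). -/
structure IsStrictSolution (S : System X X₁ Xγ Y Y₁ Yδ) (ε : ℝ)
    {δ βF βS CB MB : ℝ} (D : Splitting S.spY δ βF βS CB MB) (T : ℝ)
    (u : ℝ → X₁) (vF vS : ℝ → Y₁) : Prop where
  continuousOn_u : ContinuousOn u (Icc 0 T)
  continuousOn_vF : ContinuousOn vF (Icc 0 T)
  continuousOn_vS : ContinuousOn vS (Icc 0 T)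
  fast : ∀ t ∈ Icc 0 T, D.IsFast (vF t)
  slow : ∀ t ∈ Icc 0 T, D.IsSlow (vS t)
  deriv_u : ∀ t ∈ Icc 0 T, HasDerivWithinAt (fun s => S.spX.ι₁ (u s))
    (S.spX.gen (u t) + ε⁻¹ • S.spX.ι (S.f (u t, vF t + vS t))) (Icc 0 T) t
  deriv_vF : ∀ t ∈ Icc 0 T, HasDerivWithinAt (fun s => S.spY.ι₁ (vF s))
    (S.spY.gen (vF t) + S.spY.ι (D.prF (S.g (u t, vF t + vS t)))) (Icc 0 T) t
  deriv_vS : ∀ t ∈ Icc 0 T, HasDerivWithinAt (fun s => S.spY.ι₁ (vS s))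
    (S.spY.gen (vS t) + D.P (S.spY.ι (S.g (u t, vF t + vS t)))) (Icc 0 T) t

end

/-- The constant `L` of the spectral gap condition. Here `μ = εω_A + λ₀`, and `nF`, `nS` are the
operator norms of `pr_F : Yδ → Yδ` and `pr_S : Yδ → Y₁`. -/
noncomputable def gapConst (ε ζ μ γ δ Lf Lg CA CB MB NF NS nF nS : ℝ) : ℝ :=
  2 ^ γ * Lf * CA * Real.Gamma γ / (2 * (ε * ζ⁻¹ - 1) * μ + ε * (NS + NF)) ^ γ
    + 2 ^ δ * (Lg * nF) * CB * Real.Gamma δ / (NS - NF) ^ δ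
    + 2 * (Lg * nS) * MB * Real.Gamma δ / (NS - NF)

end FastReaction

namespace FastReaction

section Semigroup

variable {X X₁ : Type*} [NormedAddCommGroup X] [NormedSpace ℝ X]
  [NormedAddCommGroup X₁] [NormedSpace ℝ X₁]

namespace C0Semigroup

theorem tendsto_zero_right (S : C0Semigroup X) (x : X) :
    Tendsto (fun t => S.op t x) (𝓝[≥] 0) (𝓝 x) := by
  have h : (Ici (0 : ℝ)) = insert 0 (Ioi 0) := by
    ext t; simp [le_iff_eq_or_lt, eq_comm]
  rw [h, nhdsWithin_insert, tendsto_sup]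
  refine ⟨?_, S.strongly_continuous x⟩
  rw [tendsto_pure_left]
  intro s hs
  simpa [S.op_zero] using mem_of_mem_nhds hs

theorem exists_bound_near_zero [CompleteSpace X] (S : C0Semigroup X) :
    ∃ d : ℝ, 0 < d ∧ ∃ M : ℝ, ∀ t ∈ Icc 0 d, ‖S.op t‖ ≤ M := by
  by_contra! h
  have h' : ∀ n : ℕ, ∃ t ∈ Icc (0 : ℝ) (1 / ((n : ℝ) + 1)), (n : ℝ) < ‖S.op t‖ := fun n =>
    h _ (by positivity) n
  choose t ht htn using h'
  have ht0 : Tendsto t atTop (𝓝[≥] 0) := by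
    refine tendsto_nhdsWithin_iff.2 ⟨?_, Eventually.of_forall fun n => (ht n).1⟩
    exact tendsto_of_tendsto_of_tendsto_of_le_of_le tendsto_const_nhds
      tendsto_one_div_add_atTop_nhds_zero_nat (fun n => (ht n).1) (fun n => (ht n).2)
  have hb : ∀ x, ∃ C, ∀ n, ‖S.op (t n) x‖ ≤ C := fun x => by
    obtain ⟨C, hC⟩ := ((S.tendsto_zero_right x).comp ht0).norm.bddAbove_range
    exact ⟨C, fun n => hC ⟨n, rfl⟩⟩
  obtain ⟨C, hC⟩ := banach_steinhaus hb
  obtain ⟨n, hn⟩ := exists_nat_gt C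
  exact absurd (hC n) (not_le.2 (hn.trans (htn n)))

theorem exists_bound [CompleteSpace X] (S : C0Semigroup X) (τ : ℝ) :
    ∃ M : ℝ, 0 ≤ M ∧ ∀ t ∈ Icc 0 τ, ‖S.op t‖ ≤ M := by
  obtain ⟨d, hd, M, hM⟩ := S.exists_bound_near_zero
  have key : ∀ n : ℕ, ∃ K : ℝ, 0 ≤ K ∧ ∀ t ∈ Icc 0 (n * d), ‖S.op t‖ ≤ K := by
    intro n
    induction n with
    | zero =>
      refine ⟨‖S.op 0‖, norm_nonneg _, fun t ht => ?_⟩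
      have : t = 0 := le_antisymm (by simpa using ht.2) ht.1
      rw [this]
    | succ n ih =>
      obtain ⟨K, hK0, hK⟩ := ih
      refine ⟨max K (M * K), le_max_of_le_left hK0, fun t ht => ?_⟩
      rcases le_total t (n * d) with h | h
      · exact le_max_of_le_left (hK t ⟨ht.1, h⟩)
      · refine le_max_of_le_right ?_
        have h1 : t - n * d ∈ Icc 0 d := ⟨sub_nonneg.2 h, by
          have := ht.2; push_cast at this; linarith⟩
        have h2 : t = (t - n * d) + n * d := by ring
        have hnd : 0 ≤ n * d := by positivity
        rw [h2, S.op_add _ _ h1.1 hnd]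
        exact (ContinuousLinearMap.opNorm_comp_le _ _).trans
          (mul_le_mul (hM _ h1) (hK _ ⟨hnd, le_rfl⟩) (norm_nonneg _)
            ((norm_nonneg _).trans (hM _ h1)))
  obtain ⟨n, hn⟩ := exists_nat_gt (τ / d)
  obtain ⟨K, hK0, hK⟩ := key n
  exact ⟨K, hK0, fun t ht => hK t ⟨ht.1, ht.2.trans ((div_lt_iff₀ hd).1 hn).le⟩⟩

theorem op_add_apply (S : C0Semigroup X) {s t : ℝ} (hs : 0 ≤ s) (ht : 0 ≤ t) (x : X) :
    S.op (s + t) x = S.op s (S.op t x) := by rw [S.op_add s t hs ht]; rfl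

theorem continuousOn_orbit [CompleteSpace X] (S : C0Semigroup X) (x : X) :
    ContinuousOn (fun t => S.op t x) (Ici 0) := by
  intro t (ht : 0 ≤ t)
  obtain ⟨M, hM0, hM⟩ := S.exists_bound (t + 1)
  have h1 := S.tendsto_zero_right x
  rw [Metric.tendsto_nhdsWithin_nhds] at h1
  rw [ContinuousWithinAt, Metric.tendsto_nhdsWithin_nhds]
  intro e he
  obtain ⟨d, hd, h⟩ := h1 (e / (M + 1)) (by positivity)
  have key : ∀ a b : ℝ, 0 ≤ a → a ≤ t + 1 → a ≤ b → b - a < d →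
      dist (S.op b x) (S.op a x) < e := by
    intro a b ha hat hab hbd
    have h2 : b = a + (b - a) := by ring
    have hba : 0 ≤ b - a := sub_nonneg.2 hab
    have h3 : dist (S.op (b - a) x) x < e / (M + 1) := h hba (by
      rw [Real.dist_eq, sub_zero, abs_of_nonneg hba]; exact hbd)
    rw [h2, S.op_add_apply ha hba, dist_eq_norm, ← map_sub]
    rw [dist_eq_norm] at h3
    calc ‖S.op a (S.op (b - a) x - x)‖ ≤ M * ‖S.op (b - a) x - x‖ :=
          (S.op a).le_of_opNorm_le (hM a ⟨ha, hat⟩) _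
      _ ≤ M * (e / (M + 1)) := by gcongr
      _ < e := by
        rw [mul_div_assoc', div_lt_iff₀ (by positivity)]; nlinarith
  refine ⟨min d 1, by positivity, fun s (hs : 0 ≤ s) hst => ?_⟩
  rw [Real.dist_eq, lt_min_iff] at hst
  rcases le_total s t with hle | hle
  · rw [abs_sub_comm, abs_of_nonneg (sub_nonneg.2 hle)] at hst
    rw [dist_comm]
    exact key s t hs (by linarith) hle hst.1
  · rw [abs_of_nonneg (sub_nonneg.2 hle)] at hst
    exact key t s ht (by linarith) hle hst.1

end C0Semigroup

theorem continuousOn_uncurry_of_locally_bounded {V W : Type*} [NormedAddCommGroup V]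
    [NormedSpace ℝ V] [NormedAddCommGroup W] [NormedSpace ℝ W] {K : ℝ → V →L[ℝ] W} {U : Set ℝ}
    (hc : ∀ v, ContinuousOn (fun r => K r v) U)
    (hb : ∀ r ∈ U, ∃ M : ℝ, ∀ᶠ s in 𝓝[U] r, ‖K s‖ ≤ M) :
    ContinuousOn (fun p : ℝ × V => K p.1 p.2) (U ×ˢ univ) := by
  rintro ⟨r, v⟩ ⟨hr, -⟩
  obtain ⟨M, hM⟩ := hb r hr
  rw [ContinuousWithinAt, nhdsWithin_prod_eq, nhdsWithin_univ]
  have h1 : Tendsto (fun p : ℝ × V => K p.1 v) (𝓝[U] r ×ˢ 𝓝 v) (𝓝 (K r v)) :=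
    (hc v r hr).tendsto.comp tendsto_fst
  have h2 : Tendsto (fun p : ℝ × V => K p.1 (p.2 - v)) (𝓝[U] r ×ˢ 𝓝 v) (𝓝 0) := by
    refine squeeze_zero_norm' (a := fun p : ℝ × V => M * ‖p.2 - v‖) ?_ ?_
    · filter_upwards [tendsto_fst.eventually hM] with p hp
      exact (K p.1).le_of_opNorm_le hp _
    · have : Tendsto (fun p : ℝ × V => p.2) (𝓝[U] r ×ˢ 𝓝 v) (𝓝 v) := tendsto_snd
      simpa using ((this.sub_const v).norm.const_mul M)
  simpa using h1.add h2

namespace C0Semigroup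

theorem continuousOn_uncurry [CompleteSpace X] (S : C0Semigroup X) :
    ContinuousOn (fun p : ℝ × X => S.op p.1 p.2) (Ici 0 ×ˢ univ) := by
  refine continuousOn_uncurry_of_locally_bounded S.continuousOn_orbit fun r _ => ?_
  obtain ⟨M, -, hM⟩ := S.exists_bound (r + 1)
  refine ⟨M, ?_⟩
  filter_upwards [self_mem_nhdsWithin, mem_nhdsWithin_of_mem_nhds (Iic_mem_nhds (lt_add_one r))]
    with s h1 h2 using hM s ⟨h1, h2⟩

theorem intervalIntegrable_orbit [CompleteSpace X] (S : C0Semigroup X) (x : X) {a b : ℝ}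
    (ha : 0 ≤ a) (hb : 0 ≤ b) : IntervalIntegrable (fun t => S.op t x) volume a b :=
  ((S.continuousOn_orbit x).mono fun _ ht => (le_min ha hb).trans ht.1).intervalIntegrable

theorem hasDerivAt_integral_orbit [CompleteSpace X] (S : C0Semigroup X) (x : X) {t : ℝ}
    (ht : 0 < t) : HasDerivAt (fun u => ∫ s in (0 : ℝ)..u, S.op s x) (S.op t x) t := by
  refine intervalIntegral.integral_hasDerivAt_right (S.intervalIntegrable_orbit x le_rfl ht.le) ?_
    ((S.continuousOn_orbit x).continuousAt (Ici_mem_nhds ht))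
  exact ((S.continuousOn_orbit x).mono Ioi_subset_Ici_self).stronglyMeasurableAtFilter isOpen_Ioi
    t ht

theorem tendsto_average [CompleteSpace X] (S : C0Semigroup X) (x : X) :
    Tendsto (fun h : ℝ => h⁻¹ • ∫ s in (0 : ℝ)..h, S.op s x) (𝓝[>] 0) (𝓝 x) := by
  have h : HasDerivWithinAt (fun u => ∫ s in (0 : ℝ)..u, S.op s x) (S.op 0 x) (Ici 0) 0 := by
    refine intervalIntegral.integral_hasDerivWithinAt_right (by simp) (t := Ioi 0) ?_
      ((S.continuousOn_orbit x 0 self_mem_Ici).mono Ioi_subset_Ici_self)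
    exact ((S.continuousOn_orbit x).mono
      Ioi_subset_Ici_self).stronglyMeasurableAtFilter_nhdsWithin measurableSet_Ioi 0
  have h2 := (hasDerivWithinAt_iff_tendsto_slope.1 h)
  simpa [slope_fun_def, S.op_zero] using h2

end C0Semigroup

namespace IsGenerator

variable {S : C0Semigroup X} {ι A : X₁ →L[ℝ] X}

theorem tendsto_quotient (h : IsGenerator S ι A) (z : X₁) :
    Tendsto (fun t : ℝ => t⁻¹ • (S.op t (ι z) - ι z)) (𝓝[>] 0) (𝓝 (A z)) :=
  (h.2 _ _).2 ⟨z, rfl, rfl⟩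

theorem exists_op (h : IsGenerator S ι A) {t : ℝ} (ht : 0 ≤ t) (z : X₁) :
    ∃ z' : X₁, ι z' = S.op t (ι z) ∧ A z' = S.op t (A z) := by
  refine (h.2 _ _).1 ?_
  have h1 := ((S.op t).continuous.tendsto _).comp (h.tendsto_quotient z)
  refine h1.congr' ?_
  filter_upwards [self_mem_nhdsWithin] with s (hs : 0 < s)
  simp only [Function.comp, map_smul, map_sub]
  rw [← S.op_add_apply ht hs.le, ← S.op_add_apply hs.le ht, add_comm]

theorem hasDerivWithinAt_orbit (h : IsGenerator S ι A) {t : ℝ} (ht : 0 ≤ t) (z : X₁) :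
    HasDerivWithinAt (fun s => S.op s (ι z)) (S.op t (A z)) (Ioi t) t := by
  obtain ⟨z', h1, h2⟩ := h.exists_op ht z
  rw [hasDerivWithinAt_iff_tendsto_slope' self_notMem_Ioi]
  have h3 := h.tendsto_quotient z'
  rw [h1, h2] at h3
  have h4 : Tendsto (fun s : ℝ => s - t) (𝓝[>] t) (𝓝[>] 0) := by
    refine tendsto_nhdsWithin_iff.2 ⟨?_, ?_⟩
    · have : Tendsto (fun s : ℝ => s - t) (𝓝 t) (𝓝 (t - t)) := (continuous_sub_right t).tendsto t
      rw [sub_self] at this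
      exact this.mono_left nhdsWithin_le_nhds
    · filter_upwards [self_mem_nhdsWithin] with s (hs : t < s) using sub_pos.2 hs
  refine (h3.comp h4).congr' ?_
  filter_upwards [self_mem_nhdsWithin] with s (hs : t < s)
  simp only [Function.comp, slope_def_module]
  rw [← S.op_add_apply (sub_pos.2 hs).le ht, sub_add_cancel]

theorem integral_orbit [CompleteSpace X] (h : IsGenerator S ι A) {t : ℝ} (ht : 0 ≤ t) (z : X₁) :
    ∫ s in (0 : ℝ)..t, S.op s (A z) = S.op t (ι z) - ι z := by
  rw [intervalIntegral.integral_eq_sub_of_hasDeriv_right_of_le (f := fun s => S.op s (ι z)) ht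
    ((S.continuousOn_orbit _).mono Icc_subset_Ici_self)
    (fun s hs => h.hasDerivWithinAt_orbit hs.1.le z) (S.intervalIntegrable_orbit _ le_rfl ht)]
  simp [S.op_zero]

theorem hasDerivAt_orbit [CompleteSpace X] (h : IsGenerator S ι A) {t : ℝ} (ht : 0 < t) (z : X₁) :
    HasDerivAt (fun s => S.op s (ι z)) (S.op t (A z)) t := by
  refine ((S.hasDerivAt_integral_orbit (A z) ht).add_const (ι z)).congr_of_eventuallyEq ?_
  filter_upwards [Ioi_mem_nhds ht] with s hs
  rw [h.integral_orbit (le_of_lt hs)]; simp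

theorem integral_mem_domain [CompleteSpace X] (h : IsGenerator S ι A) {t : ℝ} (ht : 0 < t)
    (x : X) : ∃ z : X₁, ι z = ∫ s in (0 : ℝ)..t, S.op s x := by
  suffices H : Tendsto (fun k : ℝ => k⁻¹ • (S.op k (∫ s in (0 : ℝ)..t, S.op s x) -
      ∫ s in (0 : ℝ)..t, S.op s x)) (𝓝[>] 0) (𝓝 (S.op t x - x)) by
    obtain ⟨z, hz, -⟩ := (h.2 _ _).1 H
    exact ⟨z, hz⟩
  have h1 := (hasDerivAt_iff_tendsto_slope.1 (S.hasDerivAt_integral_orbit x ht))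
  have h4 : Tendsto (fun k : ℝ => t + k) (𝓝[>] 0) (𝓝[≠] t) := by
    refine tendsto_nhdsWithin_iff.2 ⟨?_, ?_⟩
    · have : Tendsto (fun s : ℝ => t + s) (𝓝 0) (𝓝 (t + 0)) := (continuous_const_add t).tendsto 0
      rw [add_zero] at this
      exact this.mono_left nhdsWithin_le_nhds
    · filter_upwards [self_mem_nhdsWithin] with s (hs : 0 < s)
      simp [hs.ne']
  refine ((h1.comp h4).sub (S.tendsto_average x)).congr' ?_
  filter_upwards [self_mem_nhdsWithin] with k (hk : 0 < k)
  have e1 : S.op k (∫ s in (0 : ℝ)..t, S.op s x) = ∫ s in k..(t + k), S.op s x := by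
    rw [← (S.op k).intervalIntegral_comp_comm (S.intervalIntegrable_orbit x le_rfl ht.le)]
    have : ∫ s in (0 : ℝ)..t, S.op k (S.op s x) = ∫ s in (0 : ℝ)..t, S.op (s + k) x := by
      refine intervalIntegral.integral_congr fun s hs => ?_
      rw [uIcc_of_le ht.le] at hs
      rw [← S.op_add_apply hk.le hs.1, add_comm]
    rw [this, intervalIntegral.integral_comp_add_right (fun s => S.op s x), zero_add]
  have e2 : (∫ s in (0 : ℝ)..k, S.op s x) + ∫ s in k..(t + k), S.op s x =
      ∫ s in (0 : ℝ)..(t + k), S.op s x :=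
    intervalIntegral.integral_add_adjacent_intervals
      (S.intervalIntegrable_orbit x le_rfl hk.le)
      (S.intervalIntegrable_orbit x hk.le (by positivity))
  simp only [Function.comp, slope_def_module, add_sub_cancel_left]
  rw [e1, ← smul_sub, ← e2]
  congr 1
  abel

theorem denseRange [CompleteSpace X] (h : IsGenerator S ι A) : DenseRange ι := by
  intro x
  refine mem_closure_of_tendsto (S.tendsto_average x) ?_
  filter_upwards [self_mem_nhdsWithin] with t (ht : 0 < t)
  obtain ⟨z, hz⟩ := h.integral_mem_domain ht x
  exact ⟨t⁻¹ • z, by rw [map_smul, hz]⟩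

theorem isClosed_range_graph [CompleteSpace X] (h : IsGenerator S ι A) :
    IsClosed (range (ι.prod A)) := by
  have : range (ι.prod A) = ⋂ t : Ici (0 : ℝ),
      {p : X × X | ∫ s in (0 : ℝ)..t, S.op s p.2 = S.op t p.1 - p.1} := by
    ext ⟨x, y⟩
    simp only [mem_range, ContinuousLinearMap.prod_apply, Prod.mk.injEq, mem_iInter, mem_ofPred_eq,
      Subtype.forall, mem_Ici]
    constructor
    · rintro ⟨z, rfl, rfl⟩ t ht
      exact h.integral_orbit ht z
    · intro H
      refine (h.2 _ _).1 ((S.tendsto_average y).congr' ?_)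
      filter_upwards [self_mem_nhdsWithin] with t (ht : 0 < t)
      rw [H t ht.le]
  rw [this]
  refine isClosed_iInter fun ⟨t, ht⟩ => isClosed_eq ?_ (by fun_prop)
  obtain ⟨M, hM0, hM⟩ := S.exists_bound t
  have hL : LipschitzWith (Real.toNNReal (M * t)) fun y => ∫ s in (0 : ℝ)..t, S.op s y := by
    refine LipschitzWith.of_dist_le' fun x y => ?_
    rw [dist_eq_norm, dist_eq_norm, ← intervalIntegral.integral_sub
      (S.intervalIntegrable_orbit x le_rfl ht) (S.intervalIntegrable_orbit y le_rfl ht)]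
    have := intervalIntegral.norm_integral_le_of_norm_le_const (a := 0) (b := t)
      (f := fun s => S.op s x - S.op s y) (C := M * ‖x - y‖) fun s hs => by
        rw [uIoc_of_le ht] at hs
        rw [← map_sub]
        exact (S.op s).le_of_opNorm_le (hM s ⟨hs.1.le, hs.2⟩) _
    rw [sub_zero, abs_of_nonneg ht] at this
    linarith
  exact hL.continuous.comp continuous_snd

theorem isInducing_graph [CompleteSpace X] [CompleteSpace X₁] (h : IsGenerator S ι A) :
    IsInducing (ι.prod A) := by
  have hinj : Function.Injective (ι.prod A) := fun x y hxy => h.1 (congrArg Prod.fst hxy)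
  have h2 : (ι.prod A : X₁ → X × X) = Subtype.val ∘
      ContinuousLinearMap.equivRange hinj h.isClosed_range_graph := by
    ext x <;> rfl
  rw [h2]
  exact IsInducing.subtypeVal.comp
    (ContinuousLinearMap.equivRange hinj
      h.isClosed_range_graph).toHomeomorph.isInducing

/-- The semigroup on the domain of its generator. -/
noncomputable def domainOp (h : IsGenerator S ι A) (t : ℝ) (z : X₁) : X₁ :=
  if ht : 0 ≤ t then (h.exists_op ht z).choose else 0

theorem ι_domainOp (h : IsGenerator S ι A) {t : ℝ} (ht : 0 ≤ t) (z : X₁) :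
    ι (h.domainOp t z) = S.op t (ι z) := by
  rw [domainOp, dif_pos ht]; exact (h.exists_op ht z).choose_spec.1

theorem A_domainOp (h : IsGenerator S ι A) {t : ℝ} (ht : 0 ≤ t) (z : X₁) :
    A (h.domainOp t z) = S.op t (A z) := by
  rw [domainOp, dif_pos ht]; exact (h.exists_op ht z).choose_spec.2

theorem domainOp_zero (h : IsGenerator S ι A) (z : X₁) : h.domainOp 0 z = z :=
  h.1 (by rw [h.ι_domainOp le_rfl, S.op_zero]; rfl)

theorem continuousOn_domainOp [CompleteSpace X] [CompleteSpace X₁] (h : IsGenerator S ι A)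
    (z : X₁) : ContinuousOn (fun t => h.domainOp t z) (Ici 0) := by
  rw [h.isInducing_graph.continuousOn_iff]
  refine ((S.continuousOn_orbit (ι z)).prodMk (S.continuousOn_orbit (A z))).congr fun t ht => ?_
  simp only [Function.comp, ContinuousLinearMap.prod_apply]
  rw [h.ι_domainOp ht, h.A_domainOp ht]

/-- The variation of constants formula for strict solutions of `y' = A y + φ`. -/
theorem variation_of_constants [CompleteSpace X] (h : IsGenerator S ι A) {T : ℝ}
    {y : ℝ → X₁} {φ : ℝ → X} (hφ : ContinuousOn φ (Icc 0 T))
    (hy : ∀ t ∈ Icc 0 T, HasDerivWithinAt (fun s => ι (y s)) (A (y t) + φ t) (Icc 0 T) t)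
    {t : ℝ} (ht : t ∈ Icc 0 T) :
    ι (y t) = S.op t (ι (y 0)) + ∫ s in (0 : ℝ)..t, S.op (t - s) (φ s) := by
  have hsub : Icc 0 t ⊆ Icc 0 T := Icc_subset_Icc_right ht.2
  have hyc : ContinuousOn (fun s => ι (y s)) (Icc 0 t) := fun s hs =>
    ((hy s (hsub hs)).continuousWithinAt).mono hsub
  have hop : ∀ {ψ : ℝ → X}, ContinuousOn ψ (Icc 0 t) →
      ContinuousOn (fun s => S.op (t - s) (ψ s)) (Icc 0 t) := fun hψ =>
    S.continuousOn_uncurry.comp (f := fun s => (t - s, _)) ((continuousOn_const.sub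
      continuousOn_id).prodMk hψ) fun s hs => ⟨sub_nonneg.2 hs.2, mem_univ _⟩
  have key := intervalIntegral.integral_eq_sub_of_hasDeriv_right_of_le
    (f := fun s => S.op (t - s) (ι (y s))) (f' := fun s => S.op (t - s) (φ s)) ht.1 (hop hyc)
    ?_ ((hop (hφ.mono hsub)).intervalIntegrable_of_Icc ht.1)
  · rw [key, sub_self, S.op_zero]; simp
  intro r hr
  have hd : HasDerivAt (fun s => ι (y s)) (A (y r) + φ r) r :=
    (hy r (hsub (Ioo_subset_Icc_self hr))).hasDerivAt
      (Icc_mem_nhds hr.1 (hr.2.trans_le ht.2))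
  have ho : HasDerivAt (fun s => S.op (t - s) (ι (y r))) (-S.op (t - r) (A (y r))) r := by
    have := (h.hasDerivAt_orbit (sub_pos.2 hr.2) (y r)).scomp r ((hasDerivAt_id r).const_sub t)
    rw [neg_smul, one_smul] at this
    exact this
  refine HasDerivAt.hasDerivWithinAt ?_
  rw [hasDerivAt_iff_tendsto_slope] at hd ho ⊢
  have h0 : ∀ᶠ s in 𝓝[≠] r, s < t := mem_nhdsWithin_of_mem_nhds (Iio_mem_nhds hr.2)
  have h1 : Tendsto (fun s => S.op (t - s) (slope (fun s => ι (y s)) r s)) (𝓝[≠] r)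
      (𝓝 (S.op (t - r) (A (y r) + φ r))) := by
    have hc := S.continuousOn_uncurry (t - r, A (y r) + φ r) ⟨(sub_pos.2 hr.2).le, mem_univ _⟩
    refine hc.tendsto.comp (f := fun s => (t - s, slope (fun s => ι (y s)) r s))
      (tendsto_nhdsWithin_iff.2 ⟨?_, ?_⟩)
    · refine Tendsto.prodMk_nhds ?_ hd
      exact ((continuous_const.sub continuous_id).tendsto r).mono_left nhdsWithin_le_nhds
    · filter_upwards [h0] with s hs using ⟨(sub_pos.2 hs).le, mem_univ _⟩
  have h2 := h1.add ho
  have e : S.op (t - r) (A (y r) + φ r) + -S.op (t - r) (A (y r)) = S.op (t - r) (φ r) := by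
    rw [map_add]; abel
  rw [e] at h2
  refine h2.congr fun s => ?_
  simp only [slope_def_module, map_smul, map_sub]
  rw [← smul_add]
  congr 1
  abel

end IsGenerator

theorem tendsto_const_mul_nhdsGT_zero {c : ℝ} (hc : 0 < c) :
    Tendsto (fun s : ℝ => c * s) (𝓝[>] 0) (𝓝[>] 0) := by
  refine tendsto_nhdsWithin_iff.2 ⟨?_, ?_⟩
  · have : Tendsto (fun s : ℝ => c * s) (𝓝 0) (𝓝 (c * 0)) := (continuous_const_mul c).tendsto 0
    rw [mul_zero] at this
    exact this.mono_left nhdsWithin_le_nhds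
  · filter_upwards [self_mem_nhdsWithin] with s (hs : 0 < s)
    exact mul_pos hc hs

/-- The semigroup `t ↦ e^{ctA}`. -/
def C0Semigroup.rescale (S : C0Semigroup X) (c : ℝ) (hc : 0 < c) : C0Semigroup X where
  op t := S.op (c * t)
  op_zero := by rw [mul_zero, S.op_zero]
  op_add s t hs ht := by rw [mul_add, S.op_add _ _ (by positivity) (by positivity)]
  strongly_continuous x := (S.strongly_continuous x).comp (tendsto_const_mul_nhdsGT_zero hc)

theorem IsGenerator.rescale {S : C0Semigroup X} {ι A : X₁ →L[ℝ] X} (h : IsGenerator S ι A) {c : ℝ}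
    (hc : 0 < c) : IsGenerator (S.rescale c hc) ι (c • A) := by
  refine ⟨h.1, fun x y => ?_⟩
  have key : Tendsto (fun t : ℝ => t⁻¹ • ((S.rescale c hc).op t x - x)) (𝓝[>] 0) (𝓝 y) ↔
      Tendsto (fun t : ℝ => t⁻¹ • (S.op t x - x)) (𝓝[>] 0) (𝓝 (c⁻¹ • y)) := by
    constructor
    · intro H
      refine ((H.comp (tendsto_const_mul_nhdsGT_zero (inv_pos.2 hc))).const_smul c⁻¹).congr
        fun t => ?_
      simp only [Function.comp, C0Semigroup.rescale]
      rw [mul_inv_cancel_left₀ hc.ne', smul_smul]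
      congr 1
      field_simp
    · intro H
      have := ((H.comp (tendsto_const_mul_nhdsGT_zero hc)).const_smul c)
      rw [smul_inv_smul₀ hc.ne'] at this
      refine this.congr fun t => ?_
      simp only [Function.comp, C0Semigroup.rescale]
      rw [smul_smul]
      congr 1
      field_simp
  rw [key, h.2]
  refine exists_congr fun z => and_congr_right fun _ => ?_
  simp only [_root_.smul_apply]
  rw [eq_inv_smul_iff₀ hc.ne']

end Semigroup

section Green

variable {E W : Type*} [NormedAddCommGroup E] [NormedAddCommGroup W]

/-- Functions on `(-∞, 0]` that are continuous except possibly at one point and `O(e^{ηt})`. -/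
def Admissible (η : ℝ) (w : ℝ → E) : Prop :=
  (∃ a, ContinuousOn w (Iic 0 \ {a})) ∧ ∃ K, ∀ t ≤ 0, ‖w t‖ ≤ K * Real.exp (η * t)

theorem Admissible.zero {η : ℝ} : Admissible η (0 : ℝ → E) :=
  ⟨⟨0, continuousOn_const⟩, 0, fun t _ => by simp⟩

theorem Admissible.of_continuousOn {η K : ℝ} {w : ℝ → E} (hw : ContinuousOn w (Iic 0))
    (hK : ∀ t ≤ 0, ‖w t‖ ≤ K * Real.exp (η * t)) : Admissible η w :=
  ⟨⟨0, hw.mono sdiff_subset⟩, K, hK⟩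

/-- A nonlinear kernel with Lipschitz constants `k r`, for which convolution on `(-∞, 0]` has
Lipschitz constant `L` in the norm with weight `e^{-ηt}`. -/
structure IsGreenKernel (H : ℝ → E → W) (k : ℝ → ℝ) (η L : ℝ) : Prop where
  continuousOn : ContinuousOn (fun p : ℝ × E => H p.1 p.2) ({0}ᶜ ×ˢ univ)
  map_zero : ∀ r, H r 0 = 0
  lipschitz : ∀ r x y, ‖H r x - H r y‖ ≤ k r * ‖x - y‖
  nonneg : ∀ r, 0 ≤ k r
  integrable : Integrable fun r => k r * Real.exp (-η * r)
  integral_le : ∫ r, k r * Real.exp (-η * r) ≤ L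

namespace IsGreenKernel

variable {H : ℝ → E → W} {k : ℝ → ℝ} {η L : ℝ}

theorem norm_le (h : IsGreenKernel H k η L) (r : ℝ) (x : E) : ‖H r x‖ ≤ k r * ‖x‖ := by
  simpa [h.map_zero] using h.lipschitz r x 0

theorem L_nonneg (h : IsGreenKernel H k η L) : 0 ≤ L :=
  (integral_nonneg fun r => mul_nonneg (h.nonneg r) (Real.exp_pos _).le).trans h.integral_le

theorem integrable_bound (h : IsGreenKernel H k η L) (t D : ℝ) :
    Integrable fun s => k (t - s) * (D * Real.exp (η * s)) := by
  refine ((h.integrable.comp_sub_left t).mul_const (D * Real.exp (η * t))).congr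
    (Eventually.of_forall fun s => ?_)
  have : Real.exp (η * s) = Real.exp (-η * (t - s)) * Real.exp (η * t) := by
    rw [← Real.exp_add]; ring_nf
  simp only [this]
  ring

theorem integral_bound_le (h : IsGreenKernel H k η L) (t : ℝ) {D : ℝ} (hD : 0 ≤ D) :
    ∫ s in Iic (0 : ℝ), k (t - s) * (D * Real.exp (η * s)) ≤ L * D * Real.exp (η * t) := by
  have h0 : ∀ s, 0 ≤ k (t - s) * (D * Real.exp (η * s)) := fun s =>
    mul_nonneg (h.nonneg _) (mul_nonneg hD (Real.exp_pos _).le)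
  refine (setIntegral_le_integral (h.integrable_bound t D) (Eventually.of_forall h0)).trans ?_
  have e : ∀ s, k (t - s) * (D * Real.exp (η * s)) =
      (fun r => k r * Real.exp (-η * r)) (t - s) * (D * Real.exp (η * t)) := fun s => by
    have : Real.exp (η * s) = Real.exp (-η * (t - s)) * Real.exp (η * t) := by
      rw [← Real.exp_add]; ring_nf
    simp only [this]
    ring
  simp_rw [e]
  rw [integral_mul_const, integral_sub_left_eq_self (fun r => k r * Real.exp (-η * r)) volume t,
    mul_assoc]
  exact mul_le_mul_of_nonneg_right h.integral_le (by positivity)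

theorem integrableOn (h : IsGreenKernel H k η L) {w : ℝ → E} (hw : Admissible η w) (t : ℝ) :
    IntegrableOn (fun s => H (t - s) (w s)) (Iic 0) := by
  obtain ⟨⟨a, ha⟩, K, hK⟩ := hw
  have hU : (Iic (0 : ℝ) \ {a, t} : Set ℝ) =ᵐ[volume] Iic 0 :=
    sdiff_null_ae_eq_self ((Set.toFinite _).measure_zero _)
  refine Integrable.mono' (h.integrable_bound t K).integrableOn ?_ ?_
  · rw [← Measure.restrict_congr_set hU]
    refine ContinuousOn.aestronglyMeasurable ?_ (measurableSet_Iic.diff (Set.toFinite _).measurableSet)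
    refine h.continuousOn.comp (f := fun s => (t - s, w s)) ((by fun_prop : Continuous
      fun s : ℝ => t - s).continuousOn.prodMk (ha.mono fun s hs => ⟨hs.1, fun hs' => hs.2 ?_⟩)) ?_
    · exact Or.inl hs'
    · intro s hs
      refine ⟨fun hs' => hs.2 (Or.inr ?_), mem_univ _⟩
      exact (sub_eq_zero.1 hs').symm
  · filter_upwards [ae_restrict_mem measurableSet_Iic] with s hs
    exact (h.norm_le _ _).trans (mul_le_mul_of_nonneg_left (hK s hs) (h.nonneg _))

end IsGreenKernel

variable [NormedSpace ℝ W]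

/-- Convolution with a nonlinear kernel over the half-line `(-∞, 0]`. -/
noncomputable def conv (H : ℝ → E → W) (w : ℝ → E) (t : ℝ) : W :=
  ∫ s in Iic (0 : ℝ), H (t - s) (w s)

namespace IsGreenKernel

variable {H : ℝ → E → W} {k : ℝ → ℝ} {η L : ℝ}

theorem norm_conv_sub_le (h : IsGreenKernel H k η L) {w w' : ℝ → E} (hw : Admissible η w)
    (hw' : Admissible η w') {D : ℝ} (hD : 0 ≤ D)
    (hd : ∀ s ≤ 0, ‖w s - w' s‖ ≤ D * Real.exp (η * s)) (t : ℝ) :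
    ‖conv H w t - conv H w' t‖ ≤ L * D * Real.exp (η * t) := by
  rw [conv, conv, ← integral_sub (h.integrableOn hw t) (h.integrableOn hw' t)]
  refine (norm_integral_le_of_norm_le (h.integrable_bound t D).integrableOn ?_).trans
    (h.integral_bound_le t hD)
  filter_upwards [ae_restrict_mem measurableSet_Iic] with s hs
  exact (h.lipschitz _ _ _).trans (mul_le_mul_of_nonneg_left (hd s hs) (h.nonneg _))

theorem map_conv_eq_zero [CompleteSpace W] {Z : Type*} [NormedAddCommGroup Z] [NormedSpace ℝ Z]
    [CompleteSpace Z] (h : IsGreenKernel H k η L) {w : ℝ → E} (hw : Admissible η w) {j : W →L[ℝ] Z}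
    (hj : ∀ r x, j (H r x) = 0) (t : ℝ) : j (conv H w t) = 0 := by
  rw [conv, ← j.integral_comp_comm (h.integrableOn hw t)]
  simp [hj]

theorem conv_zero (h : IsGreenKernel H k η L) (t : ℝ) : conv H 0 t = 0 := by
  simp [conv, h.map_zero]

theorem conv_eq_integral (h : IsGreenKernel H k η L) (w : ℝ → E) (t : ℝ) :
    conv H w t = ∫ r, H r ((Iic (0 : ℝ)).indicator w (t - r)) := by
  rw [conv, ← integral_indicator measurableSet_Iic,
    ← integral_sub_left_eq_self (fun r => H r ((Iic (0 : ℝ)).indicator w (t - r))) volume t]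
  refine integral_congr_ae (Eventually.of_forall fun s => ?_)
  by_cases hs : s ∈ Iic (0 : ℝ) <;> simp [hs, h.map_zero]

theorem continuous_conv (h : IsGreenKernel H k η L) {w : ℝ → E} (hw : Admissible η w) :
    Continuous (conv H w) := by
  have e : conv H w = fun t => ∫ r, H r ((Iic (0 : ℝ)).indicator w (t - r)) :=
    funext (h.conv_eq_integral w)
  rw [e, continuous_iff_continuousAt]
  intro t₀
  have hmeas : ∀ t, AEStronglyMeasurable
      (fun r => H r ((Iic (0 : ℝ)).indicator w (t - r))) volume := fun t => by
    have := ((integrable_indicator_iff measurableSet_Iic).2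
      (h.integrableOn hw t)).comp_sub_left t
    refine this.aestronglyMeasurable.congr (Eventually.of_forall fun r => ?_)
    by_cases hs : t - r ∈ Iic (0 : ℝ)
    · simp only [indicator_of_mem hs, sub_sub_cancel]
    · simp only [indicator_of_notMem hs, h.map_zero]
  obtain ⟨⟨a, ha⟩, K, hK⟩ := hw
  have hK0 : 0 ≤ K := by simpa using (norm_nonneg _).trans (hK 0 le_rfl)
  refine continuousAt_of_dominated
    (bound := fun r => k r * Real.exp (-η * r) * (K * Real.exp (|η| * (|t₀| + 1))))
    (Eventually.of_forall hmeas) ?_ (h.integrable.mul_const _) ?_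
  · filter_upwards [Metric.ball_mem_nhds t₀ one_pos] with t ht
    refine Eventually.of_forall fun r => (h.norm_le _ _).trans ?_
    rw [mul_assoc]
    refine mul_le_mul_of_nonneg_left ?_ (h.nonneg _)
    by_cases hs : t - r ∈ Iic (0 : ℝ)
    · rw [indicator_of_mem hs]
      refine (hK _ hs).trans ?_
      have h1 : η * t ≤ |η| * (|t₀| + 1) := by
        have h2 : |t| ≤ |t₀| + 1 := by
          have h3 : |t - t₀| < 1 := ht
          have h4 := abs_sub_abs_le_abs_sub t t₀
          linarith
        calc η * t ≤ |η| * |t| := by rw [← abs_mul]; exact le_abs_self _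
          _ ≤ _ := by gcongr
      have h5 : Real.exp (η * (t - r)) ≤ Real.exp (-η * r) * Real.exp (|η| * (|t₀| + 1)) := by
        rw [← Real.exp_add]
        exact Real.exp_le_exp.2 (by linarith)
      calc _ ≤ K * (Real.exp (-η * r) * Real.exp (|η| * (|t₀| + 1))) := by gcongr
        _ = _ := by ring
    · rw [indicator_of_notMem hs, norm_zero]; positivity
  · have : ({0, t₀, t₀ - a} : Set ℝ)ᶜ ∈ ae volume :=
      compl_mem_ae_iff.2 ((Set.toFinite _).measure_zero _)
    filter_upwards [this] with r hr
    simp only [mem_compl_iff, mem_insert_iff, mem_singleton_iff, not_or] at hr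
    obtain ⟨hr0, hrt, hra⟩ := hr
    have hind : ContinuousAt ((Iic (0 : ℝ)).indicator w) (t₀ - r) := by
      rcases lt_or_gt_of_ne (sub_ne_zero.2 (Ne.symm hrt)) with hlt | hgt
      · have hU : Iio (0 : ℝ) \ {a} ∈ 𝓝 (t₀ - r) :=
          (isOpen_Iio.sdiff isClosed_singleton).mem_nhds ⟨hlt, fun h' => hra (by
            rw [mem_singleton_iff] at h'; linarith)⟩
        refine ((ha.mono (sdiff_subset_sdiff_left Iio_subset_Iic_self)).continuousAt hU).congr ?_
        filter_upwards [hU] with s hs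
        rw [indicator_of_mem (Iio_subset_Iic_self hs.1)]
      · refine (continuousAt_const (y := (0 : E))).congr ?_
        filter_upwards [Ioi_mem_nhds hgt] with s (hs : 0 < s)
        rw [indicator_of_notMem (by simpa using hs)]
    have hH : ContinuousAt (fun p : ℝ × E => H p.1 p.2)
        (r, (Iic (0 : ℝ)).indicator w (t₀ - r)) :=
      h.continuousOn.continuousAt ((isOpen_compl_singleton.prod isOpen_univ).mem_nhds
        ⟨hr0, mem_univ _⟩)
    have hg : ContinuousAt (fun t => (r, (Iic (0 : ℝ)).indicator w (t - r))) t₀ :=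
      continuousAt_const.prodMk (hind.comp (f := fun t => t - r)
        (continuous_sub_right r).continuousAt)
    exact hH.comp (f := fun t => (r, (Iic (0 : ℝ)).indicator w (t - r))) hg

end IsGreenKernel

/-- A map with Lipschitz constant `L` in the norm with weight `e^{-ηt}` on `(-∞, 0]`. -/
structure IsWeightedLipschitz (Φ : (ℝ → E) → ℝ → E) (η L : ℝ) : Prop where
  nonneg : 0 ≤ L
  map_zero : ∀ t, Φ 0 t = 0
  continuousOn : ∀ w, Admissible η w → ContinuousOn (Φ w) (Iic 0)
  lipschitz : ∀ w w', Admissible η w → Admissible η w' → ∀ D, 0 ≤ D →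
    (∀ s ≤ 0, ‖w s - w' s‖ ≤ D * Real.exp (η * s)) →
    ∀ t ≤ 0, ‖Φ w t - Φ w' t‖ ≤ L * D * Real.exp (η * t)

namespace IsWeightedLipschitz

variable {Φ : (ℝ → E) → ℝ → E} {η L : ℝ}

/-- Solutions of `w = p + Φ w` depend continuously on `p`. -/
theorem norm_sub_le (h : IsWeightedLipschitz Φ η L) (hL : L < 1) {w w' p p' : ℝ → E} {R : ℝ}
    (hw : Admissible η w) (hw' : Admissible η w')
    (e : ∀ t ≤ 0, w t = p t + Φ w t) (e' : ∀ t ≤ 0, w' t = p' t + Φ w' t)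
    (hp : ∀ t ≤ 0, ‖p t - p' t‖ ≤ R * Real.exp (η * t)) {t : ℝ} (ht : t ≤ 0) :
    ‖w t - w' t‖ ≤ R / (1 - L) * Real.exp (η * t) := by
  set q : ℝ → ℝ := fun t => ‖w t - w' t‖ * Real.exp (-(η * t))
  have hq : ∀ t, ‖w t - w' t‖ = q t * Real.exp (η * t) := fun t => by
    simp only [q, mul_assoc, ← Real.exp_add]; simp
  obtain ⟨K, hK⟩ := hw.2
  obtain ⟨K', hK'⟩ := hw'.2
  have hle : ∀ {t D}, ‖w t - w' t‖ ≤ D * Real.exp (η * t) → q t ≤ D := fun {t D} h1 => by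
    rw [hq] at h1; exact le_of_mul_le_mul_right h1 (Real.exp_pos _)
  have hbdd : BddAbove (q '' Iic 0) := by
    refine ⟨K + K', ?_⟩
    rintro _ ⟨s, hs, rfl⟩
    refine hle ((_root_.norm_sub_le _ _).trans ?_)
    rw [add_mul]
    exact add_le_add (hK s hs) (hK' s hs)
  set D := sSup (q '' Iic 0)
  have hqD : ∀ s ≤ 0, q s ≤ D := fun s hs => le_csSup hbdd ⟨s, hs, rfl⟩
  have hD0 : 0 ≤ D := (mul_nonneg (norm_nonneg _) (Real.exp_pos _).le).trans (hqD 0 le_rfl)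
  have hD : D ≤ R + L * D := by
    refine csSup_le ⟨_, 0, self_mem_Iic, rfl⟩ ?_
    rintro _ ⟨s, hs, rfl⟩
    refine hle ?_
    rw [e s hs, e' s hs, add_sub_add_comm, add_mul]
    refine (norm_add_le _ _).trans (add_le_add (hp s hs) (h.lipschitz w w' hw hw' D hD0 ?_ s hs))
    intro r hr
    rw [hq]
    exact mul_le_mul_of_nonneg_right (hqD r hr) (Real.exp_pos _).le
  have hD' : D ≤ R / (1 - L) := by
    rw [le_div_iff₀ (by linarith)]; linarith
  rw [hq]
  exact mul_le_mul_of_nonneg_right ((hqD t ht).trans hD') (Real.exp_pos _).le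

variable [NormedSpace ℝ E] [CompleteSpace E]

theorem exists_solution (h : IsWeightedLipschitz Φ η L) (hL : L < 1) {p : ℝ → E} {R : ℝ}
    (hpc : ContinuousOn p (Iic 0)) (hp : ∀ t ≤ 0, ‖p t‖ ≤ R * Real.exp (η * t)) :
    ∃ w : ℝ → E, ContinuousOn w (Iic 0) ∧ (∃ K, ∀ t ≤ 0, ‖w t‖ ≤ K * Real.exp (η * t)) ∧
      ∀ t ≤ 0, w t = p t + Φ w t := by
  let ext : BoundedContinuousFunction (Iic (0 : ℝ)) E → ℝ → E := fun v s =>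
    Real.exp (η * s) • v ⟨min s 0, mem_Iic.2 (min_le_right s 0)⟩
  have hext : ∀ v s, ‖ext v s‖ ≤ ‖v‖ * Real.exp (η * s) := fun v s => by
    rw [norm_smul, Real.norm_eq_abs, Real.abs_exp, mul_comm]
    exact mul_le_mul_of_nonneg_right (v.norm_coe_le_norm _) (Real.exp_pos _).le
  have hext_sub : ∀ v v' s, ext v s - ext v' s = ext (v - v') s := fun v v' s => by
    simp [ext, smul_sub]
  have hextc : ∀ v, Continuous (ext v) := fun v => by
    refine Continuous.smul (by fun_prop) (v.continuous.comp ?_)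
    exact Continuous.subtype_mk (by fun_prop) _
  have hadm : ∀ v, Admissible η (ext v) := fun v =>
    .of_continuousOn (hextc v).continuousOn fun s _ => hext v s
  have hexp : ∀ t, Real.exp (-(η * t)) * Real.exp (η * t) = 1 := fun t => by
    rw [← Real.exp_add]; simp
  let Ψ : BoundedContinuousFunction (Iic (0 : ℝ)) E → BoundedContinuousFunction (Iic (0 : ℝ)) E :=
    fun v => BoundedContinuousFunction.ofNormedAddCommGroup
      (fun s => Real.exp (-(η * s)) • (p s + Φ (ext v) s))
      (by
        refine Continuous.smul (by fun_prop) ?_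
        exact continuousOn_iff_continuous_domRestrict.1 (hpc.add (h.continuousOn _ (hadm v))))
      (R + L * ‖v‖) (by
        rintro ⟨s, hs⟩
        rw [norm_smul, Real.norm_eq_abs, Real.abs_exp]
        have h1 := h.lipschitz _ 0 (hadm v) .zero ‖v‖ (norm_nonneg _)
          (fun r _ => by simpa using hext v r) s hs
        rw [h.map_zero, sub_zero] at h1
        calc _ ≤ Real.exp (-(η * s)) * (R * Real.exp (η * s) + L * ‖v‖ * Real.exp (η * s)) := by
              gcongr; exact (norm_add_le _ _).trans (add_le_add (hp s hs) h1)
          _ = (R + L * ‖v‖) * (Real.exp (-(η * s)) * Real.exp (η * s)) := by ring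
          _ = _ := by rw [hexp, mul_one])
  have hΨ : ContractingWith L.toNNReal Ψ := by
    refine ⟨by rwa [← NNReal.coe_lt_coe, Real.coe_toNNReal _ h.nonneg],
      LipschitzWith.of_dist_le_mul fun v v' => ?_⟩
    rw [Real.coe_toNNReal _ h.nonneg]
    rw [BoundedContinuousFunction.dist_le (mul_nonneg h.nonneg dist_nonneg)]
    rintro ⟨s, hs⟩
    have h1 := h.lipschitz _ _ (hadm v) (hadm v') ‖v - v'‖ (norm_nonneg _)
      (fun r _ => by rw [hext_sub]; exact hext _ r) s hs
    rw [dist_eq_norm, dist_eq_norm]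
    change ‖Real.exp (-(η * s)) • (p s + Φ (ext v) s) -
      Real.exp (-(η * s)) • (p s + Φ (ext v') s)‖ ≤ L * ‖v - v'‖
    rw [← smul_sub, add_sub_add_left_eq_sub, norm_smul, Real.norm_eq_abs, Real.abs_exp]
    calc _ ≤ Real.exp (-(η * s)) * (L * ‖v - v'‖ * Real.exp (η * s)) := by gcongr
      _ = L * ‖v - v'‖ * (Real.exp (-(η * s)) * Real.exp (η * s)) := by ring
      _ = _ := by rw [hexp, mul_one]
  set v := hΨ.fixedPoint
  have hv : Ψ v = v := hΨ.fixedPoint_isFixedPt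
  refine ⟨ext v, (hextc v).continuousOn, ⟨‖v‖, fun t _ => hext v t⟩, fun t ht => ?_⟩
  have h1 : v ⟨t, ht⟩ = Real.exp (-(η * t)) • (p t + Φ (ext v) t) := by
    conv_lhs => rw [← hv]
    rfl
  have h2 : ext v t = Real.exp (η * t) • v ⟨t, ht⟩ := by
    simp only [ext, min_eq_left ht]
  rw [h2, h1, smul_smul, mul_comm, hexp, one_smul]

end IsWeightedLipschitz

end Green

section Kernels

variable {E V W Z : Type*} [NormedAddCommGroup E] [NormedAddCommGroup V] [NormedSpace ℝ V]
  [NormedAddCommGroup W] [NormedSpace ℝ W] [NormedAddCommGroup Z] [NormedSpace ℝ Z]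

theorem one_le_Gamma_of_mem_Ioc {a : ℝ} (ha : a ∈ Ioc (0 : ℝ) 1) : 1 ≤ Real.Gamma a := by
  rcases ha.2.eq_or_lt with rfl | h1
  · rw [Real.Gamma_one]
  · have := Real.convexOn_Gamma.slope_mono_adjacent (x := a) (y := 1) (z := 2) ha.1
      (by norm_num : (2 : ℝ) ∈ Ioi 0) h1 one_lt_two
    rw [Real.Gamma_one, Real.Gamma_two, sub_self, zero_div, div_le_iff₀ (by linarith)] at this
    linarith

theorem continuousOn_kernel_comp {K : ℝ → V →L[ℝ] W} {U : Set ℝ} {N : E → V} (hN : Continuous N)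
    (hc : ∀ v, ContinuousOn (fun r => K r v) U)
    (hb : ∀ r ∈ U, ∃ M : ℝ, ∀ᶠ s in 𝓝[U] r, ‖K s‖ ≤ M) :
    ContinuousOn (fun p : ℝ × E => K p.1 (N p.2)) (U ×ˢ univ) :=
  (continuousOn_uncurry_of_locally_bounded hc hb).comp
    (f := fun p : ℝ × E => (p.1, N p.2)) (by fun_prop) fun p hp => ⟨hp.1, mem_univ _⟩

theorem exists_eventually_norm_le {K : ℝ → V →L[ℝ] W} {U : Set ℝ} {b : ℝ → ℝ}
    (hK : ∀ r ∈ U, ‖K r‖ ≤ b r) (hb : ContinuousOn b U) :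
    ∀ r ∈ U, ∃ M : ℝ, ∀ᶠ s in 𝓝[U] r, ‖K s‖ ≤ M := fun r hr => by
  refine ⟨b r + 1, ?_⟩
  filter_upwards [self_mem_nhdsWithin, (hb r hr).eventually (Iio_mem_nhds (lt_add_one _))]
    with s h1 h2 using (hK s h1).trans (le_of_lt h2)

theorem isGreenKernel_fast {K : ℝ → V →L[ℝ] W} {N : E → V} {l C a β η : ℝ}
    (hN : ∀ x y, ‖N x - N y‖ ≤ l * ‖x - y‖) (hN0 : N 0 = 0) (hl : 0 ≤ l) (hC : 0 ≤ C)
    (ha : 0 < a) (hβ : β < η) (hK : ∀ r, 0 < r → ‖K r‖ ≤ C * r ^ (a - 1) * Real.exp (β * r))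
    (hc : ∀ v, ContinuousOn (fun r => K r v) (Ioi 0)) :
    IsGreenKernel (fun r x => if 0 < r then K r (N x) else 0)
      (fun r => if 0 < r then l * (C * r ^ (a - 1) * Real.exp (β * r)) else 0) η
      (l * C * Real.Gamma a / (η - β) ^ a) := by
  have hNc : Continuous N := (LipschitzWith.of_dist_le' (K := l) fun x y => by
    simpa [dist_eq_norm] using hN x y).continuous
  have hηβ : 0 < η - β := sub_pos.2 hβ
  have hGam := Real.integral_rpow_mul_exp_neg_mul_Ioi ha hηβ
  have hint0 : IntegrableOn (fun t : ℝ => t ^ (a - 1) * Real.exp (-((η - β) * t))) (Ioi 0) := by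
    by_contra hcon
    rw [integral_undef hcon] at hGam
    have := mul_pos (Real.rpow_pos_of_pos (one_div_pos.2 hηβ) a) (Real.Gamma_pos_of_pos ha)
    linarith
  have e : (fun r => (if 0 < r then l * (C * r ^ (a - 1) * Real.exp (β * r)) else 0) *
      Real.exp (-η * r)) = (Ioi (0 : ℝ)).indicator
        fun t => l * C * (t ^ (a - 1) * Real.exp (-((η - β) * t))) := by
    ext r
    by_cases hr : 0 < r
    · rw [if_pos hr, indicator_of_mem (mem_Ioi.2 hr)]
      have : Real.exp (-((η - β) * r)) = Real.exp (β * r) * Real.exp (-η * r) := by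
        rw [← Real.exp_add]; ring_nf
      rw [this]; ring
    · rw [if_neg hr, indicator_of_notMem (by simpa using hr), zero_mul]
  refine ⟨?_, fun r => ?_, fun r x y => ?_, fun r => ?_, ?_, ?_⟩
  · rintro ⟨r, x⟩ ⟨hr, -⟩
    refine ContinuousAt.continuousWithinAt ?_
    rcases lt_or_gt_of_ne (show r ≠ 0 from hr) with h | h
    · refine (continuousAt_const (y := (0 : W))).congr ?_
      filter_upwards [(isOpen_Iio.prod isOpen_univ).mem_nhds
        (show (r, x) ∈ Iio (0 : ℝ) ×ˢ univ from ⟨h, mem_univ _⟩)] with p hp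
      rw [if_neg (not_lt.2 (le_of_lt hp.1))]
    · have hU := (isOpen_Ioi.prod isOpen_univ).mem_nhds
        (show (r, x) ∈ Ioi (0 : ℝ) ×ˢ univ from ⟨h, mem_univ _⟩)
      have hbc : ContinuousOn (fun r : ℝ => C * r ^ (a - 1) * Real.exp (β * r)) (Ioi 0) :=
        (continuousOn_const.mul (continuousOn_id.rpow_const fun s hs => Or.inl
          (ne_of_gt hs))).mul (by fun_prop)
      refine ((continuousOn_kernel_comp hNc hc
        (exists_eventually_norm_le hK hbc)).continuousAt hU).congr ?_
      filter_upwards [hU] with p hp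
      rw [if_pos (mem_Ioi.1 hp.1)]
  · simp [hN0]
  · split_ifs with hr
    · rw [← map_sub]
      calc _ ≤ C * r ^ (a - 1) * Real.exp (β * r) * ‖N x - N y‖ := (K r).le_of_opNorm_le (hK r hr) _
        _ ≤ C * r ^ (a - 1) * Real.exp (β * r) * (l * ‖x - y‖) := by gcongr; exact hN x y
        _ = _ := by ring
    · simp
  · split_ifs with hr
    · positivity
    · exact le_rfl
  · rw [e, integrable_indicator_iff measurableSet_Ioi]
    exact hint0.const_mul _
  · rw [e, integral_indicator measurableSet_Ioi, integral_const_mul, hGam, Real.div_rpow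
      zero_le_one hηβ.le, Real.one_rpow]
    exact le_of_eq (by ring)

theorem integral_exp_mul_Iio {b : ℝ} (hb : 0 < b) :
    ∫ r in Iio (0 : ℝ), Real.exp (b * r) = 1 / b := by
  rw [← integral_Iic_eq_integral_Iio, integral_exp_mul_Iic hb]; simp

theorem isGreenKernel_slow {K : ℝ → V →L[ℝ] W} {N : E → V} {l C β η : ℝ}
    (hN : ∀ x y, ‖N x - N y‖ ≤ l * ‖x - y‖) (hN0 : N 0 = 0) (hl : 0 ≤ l) (hC : 0 ≤ C)
    (hβ : η < β) (hK : ∀ r, r < 0 → ‖K r‖ ≤ C * Real.exp (β * r))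
    (hc : ∀ v, ContinuousOn (fun r => K r v) (Iio 0)) :
    IsGreenKernel (fun r x => if r < 0 then -K r (N x) else 0)
      (fun r => if r < 0 then l * (C * Real.exp (β * r)) else 0) η (l * C / (β - η)) := by
  have hNc : Continuous N := (LipschitzWith.of_dist_le' (K := l) fun x y => by
    simpa [dist_eq_norm] using hN x y).continuous
  have hηβ : 0 < β - η := sub_pos.2 hβ
  have hexp := integral_exp_mul_Iio hηβ
  have hint0 : IntegrableOn (fun t : ℝ => Real.exp ((β - η) * t)) (Iio 0) := by
    by_contra hcon
    rw [integral_undef hcon] at hexp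
    have := one_div_pos.2 hηβ
    linarith
  have e : (fun r => (if r < 0 then l * (C * Real.exp (β * r)) else 0) *
      Real.exp (-η * r)) = (Iio (0 : ℝ)).indicator
        fun t => l * C * Real.exp ((β - η) * t) := by
    ext r
    by_cases hr : r < 0
    · rw [if_pos hr, indicator_of_mem (mem_Iio.2 hr)]
      have : Real.exp ((β - η) * r) = Real.exp (β * r) * Real.exp (-η * r) := by
        rw [← Real.exp_add]; ring_nf
      rw [this]; ring
    · rw [if_neg hr, indicator_of_notMem (by simpa using hr), zero_mul]
  refine ⟨?_, fun r => ?_, fun r x y => ?_, fun r => ?_, ?_, ?_⟩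
  · rintro ⟨r, x⟩ ⟨hr, -⟩
    refine ContinuousAt.continuousWithinAt ?_
    rcases lt_or_gt_of_ne (show r ≠ 0 from hr) with h | h
    · have hU := (isOpen_Iio.prod isOpen_univ).mem_nhds
        (show (r, x) ∈ Iio (0 : ℝ) ×ˢ univ from ⟨h, mem_univ _⟩)
      refine ((continuousOn_kernel_comp hNc hc (exists_eventually_norm_le hK
        (by fun_prop))).continuousAt hU).neg.congr ?_
      filter_upwards [hU] with p hp
      rw [if_pos (mem_Iio.1 hp.1), Pi.neg_apply]
    · refine (continuousAt_const (y := (0 : W))).congr ?_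
      filter_upwards [(isOpen_Ioi.prod isOpen_univ).mem_nhds
        (show (r, x) ∈ Ioi (0 : ℝ) ×ˢ univ from ⟨h, mem_univ _⟩)] with p hp
      rw [if_neg (not_lt.2 (le_of_lt hp.1))]
  · simp [hN0]
  · split_ifs with hr
    · rw [← neg_sub', norm_neg, ← map_sub]
      calc _ ≤ C * Real.exp (β * r) * ‖N x - N y‖ := (K r).le_of_opNorm_le (hK r hr) _
        _ ≤ C * Real.exp (β * r) * (l * ‖x - y‖) := by gcongr; exact hN x y
        _ = _ := by ring
    · simp
  · split_ifs with hr
    · positivity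
    · exact le_rfl
  · rw [e, integrable_indicator_iff measurableSet_Iio]
    exact hint0.const_mul _
  · rw [e, integral_indicator measurableSet_Iio, integral_const_mul, hexp]
    exact le_of_eq (by ring)

theorem map_conv_fast [CompleteSpace W] [CompleteSpace Z] {K : ℝ → V →L[ℝ] W} {N : E → V}
    {k : ℝ → ℝ} {η L : ℝ} (h : IsGreenKernel (fun r x => if 0 < r then K r (N x) else 0) k η L)
    (j : W →L[ℝ] Z) {F : ℝ → V → Z} (hF : ∀ r, 0 < r → ∀ v, j (K r v) = F r v)
    {w : ℝ → E} (hw : Admissible η w) {t : ℝ} (ht : t ≤ 0) :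
    IntegrableOn (fun s => F (t - s) (N (w s))) (Iic t) ∧
    j (conv (fun r x => if 0 < r then K r (N x) else 0) w t) =
      ∫ s in Iic t, F (t - s) (N (w s)) := by
  have hint := h.integrableOn hw t
  have e : (fun s => j (if 0 < t - s then K (t - s) (N (w s)) else 0)) =
      (Iio t).indicator fun s => F (t - s) (N (w s)) := by
    ext s
    by_cases hs : s < t
    · rw [if_pos (sub_pos.2 hs), hF _ (sub_pos.2 hs), indicator_of_mem (mem_Iio.2 hs)]
    · rw [if_neg (by simpa using hs), indicator_of_notMem (by simpa using hs), map_zero]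
  have hsub : Iic (0 : ℝ) ∩ Iio t = Iio t :=
    inter_eq_right.2 fun s hs => (le_of_lt hs).trans ht
  constructor
  · have h1 : IntegrableOn (fun s => j (if 0 < t - s then K (t - s) (N (w s)) else 0)) (Iic 0) :=
      j.integrable_comp hint
    rw [e] at h1
    have h2 := h1.integrable.indicator (μ := volume.restrict (Iic 0)) (s := Iio t) measurableSet_Iio
    rw [integrable_indicator_iff measurableSet_Iio, IntegrableOn, Measure.restrict_restrict
      measurableSet_Iio, inter_comm, hsub] at h2
    rw [integrableOn_Iic_iff_integrableOn_Iio]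
    refine IntegrableOn.congr_fun h2 (fun s hs => ?_) measurableSet_Iio
    rw [indicator_of_mem hs]
  · rw [conv, ← j.integral_comp_comm hint, e, setIntegral_indicator measurableSet_Iio, hsub,
      integral_Iic_eq_integral_Iio]

theorem map_conv_slow [CompleteSpace W] [CompleteSpace Z] {K : ℝ → V →L[ℝ] W} {N : E → V}
    {k : ℝ → ℝ} {η L : ℝ} (h : IsGreenKernel (fun r x => if r < 0 then -K r (N x) else 0) k η L)
    (j : W →L[ℝ] Z) {F : ℝ → V → Z} (hF : ∀ r, r < 0 → ∀ v, j (K r v) = F r v)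
    {w : ℝ → E} (hw : Admissible η w) {t : ℝ} (ht : t ≤ 0) :
    j (conv (fun r x => if r < 0 then -K r (N x) else 0) w t) =
      ∫ s in (0 : ℝ)..t, F (t - s) (N (w s)) := by
  have e : (fun s => j (if t - s < 0 then -K (t - s) (N (w s)) else 0)) =
      (Ioi t).indicator fun s => -F (t - s) (N (w s)) := by
    ext s
    by_cases hs : t < s
    · rw [if_pos (sub_neg.2 hs), map_neg, hF _ (sub_neg.2 hs), indicator_of_mem (mem_Ioi.2 hs)]
    · rw [if_neg (by simpa using hs), indicator_of_notMem (by simpa using hs), map_zero]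
  have hsub : Iic (0 : ℝ) ∩ Ioi t = Ioc t 0 := by
    ext s; simp [and_comm]
  rw [conv, ← j.integral_comp_comm (h.integrableOn hw t), e, setIntegral_indicator
    measurableSet_Ioi, hsub, intervalIntegral.integral_of_ge ht, integral_neg]

theorem exists_lift {j : W →L[ℝ] Z} (hj : Function.Injective j) (F : V →L[ℝ] Z) {b : ℝ}
    (h : ∀ v, ∃ w, j w = F v ∧ ‖w‖ ≤ b * ‖v‖) :
    ∃ G : V →L[ℝ] W, (∀ v, j (G v) = F v) ∧ ∀ v, ‖G v‖ ≤ b * ‖v‖ := by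
  choose G hG hb using h
  exact ⟨LinearMap.mkContinuous
    { toFun := G
      map_add' := fun x y => hj (by simp [hG])
      map_smul' := fun c x => hj (by simp [hG]) } b hb, hG, hb⟩

/-- The smoothing operators of a semigroup, as maps into the domain of the generator. -/
theorem IsGenerator.exists_smoothing {X X₁ : Type*} [NormedAddCommGroup X] [NormedSpace ℝ X]
    [NormedAddCommGroup X₁] [NormedSpace ℝ X₁] [CompleteSpace X] [CompleteSpace X₁]
    {S : C0Semigroup X} {ι A : X₁ →L[ℝ] X} (h : IsGenerator S ι A) (i : V →L[ℝ] X) {b : ℝ → ℝ}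
    (hb0 : ∀ t, 0 < t → 0 ≤ b t)
    (hb : ∀ t, 0 < t → ∀ v, ∃ z : X₁, ι z = S.op t (i v) ∧ ‖z‖ ≤ b t * ‖v‖) :
    ∃ K : ℝ → V →L[ℝ] X₁, (∀ t, 0 < t → ∀ v, ι (K t v) = S.op t (i v)) ∧
      (∀ t, 0 < t → ‖K t‖ ≤ b t) ∧ ∀ v, ContinuousOn (fun t => K t v) (Ioi 0) := by
  have : ∀ t, ∃ K : V →L[ℝ] X₁, 0 < t → (∀ v, ι (K v) = S.op t (i v)) ∧ ‖K‖ ≤ b t := fun t => by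
    by_cases ht : 0 < t
    · obtain ⟨G, h1, h2⟩ := exists_lift h.1 ((S.op t).comp i) (hb t ht)
      exact ⟨G, fun _ => ⟨h1, G.opNorm_le_bound (hb0 t ht) h2⟩⟩
    · exact ⟨0, fun h' => absurd h' ht⟩
  choose K hK using this
  refine ⟨K, fun t ht => (hK t ht).1, fun t ht => (hK t ht).2, fun v t (ht : 0 < t) => ?_⟩
  have ht2 : 0 < t / 2 := half_pos ht
  have hU : Ioi (t / 2) ∈ 𝓝 t := Ioi_mem_nhds (half_lt_self ht)
  refine ContinuousAt.continuousWithinAt ?_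
  have h1 : ContinuousOn (fun s => h.domainOp (s - t / 2) (K (t / 2) v)) (Ioi (t / 2)) :=
    (h.continuousOn_domainOp _).comp (f := fun s => s - t / 2) (by fun_prop)
      fun s (hs : t / 2 < s) => (sub_pos.2 hs).le
  refine (h1.continuousAt hU).congr ?_
  filter_upwards [hU] with s (hs : t / 2 < s)
  refine h.1 ?_
  rw [h.ι_domainOp (sub_pos.2 hs).le, (hK _ ht2).1, (hK s (ht2.trans hs)).1,
    ← S.op_add_apply (sub_pos.2 hs).le ht2.le, sub_add_cancel]

end Kernels

theorem C0Group.continuous_orbit {X : Type*} [NormedAddCommGroup X] [NormedSpace ℝ X]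
    (G : C0Group X) (x : X) : Continuous fun t => G.op t x := by
  rw [continuous_iff_continuousAt]
  intro t
  have h1 : Tendsto (fun s : ℝ => s - t) (𝓝 t) (𝓝 0) := by
    have : Tendsto (fun s : ℝ => s - t) (𝓝 t) (𝓝 (t - t)) := (continuous_sub_right t).tendsto t
    rwa [sub_self] at this
  refine ((((G.op t).continuous.tendsto x).comp (G.strongly_continuous x)).comp h1).congr fun s => ?_
  change (G.op t).comp (G.op (s - t)) x = _
  rw [← G.op_add, add_sub_cancel]

section

variable {Y Y₁ Yδ : Type*} [NormedAddCommGroup Y] [NormedSpace ℝ Y]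
  [NormedAddCommGroup Y₁] [NormedSpace ℝ Y₁] [NormedAddCommGroup Yδ] [NormedSpace ℝ Yδ]
  {sp : Scale Y Y₁ Yδ}

theorem Scale.isInducing_gen (sp : Scale Y Y₁ Yδ) : IsInducing sp.gen :=
  (AddMonoidHomClass.isometry_of_norm sp.gen sp.norm_gen).isUniformInducing.isInducing

namespace Splitting

variable {δ βF βS CB MB : ℝ} (D : Splitting sp δ βF βS CB MB)

theorem P_of_mem_range {y : Y} (hy : y ∈ D.P.range) : D.P y = y := by
  obtain ⟨x, rfl⟩ := hy
  exact D.P_idem x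

theorem isSlow_iff {y : Y₁} : D.IsSlow y ↔ D.P (sp.ι₁ y) = sp.ι₁ y :=
  ⟨D.P_of_mem_range, fun h => ⟨_, h⟩⟩

theorem P_slowFlow (t : ℝ) (y : Y) : D.P (D.slowFlow t y) = D.slowFlow t y :=
  D.P_of_mem_range (D.group.op t _).2

theorem slowFlow_P (t : ℝ) (y : Y) : D.slowFlow t (D.P y) = D.slowFlow t y := by
  simp only [slowFlow, D.P_idem]

theorem slowFlow_zero (y : Y) : D.slowFlow 0 y = D.P y := by
  simp only [slowFlow, D.group.op_zero, ContinuousLinearMap.id_apply]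

theorem slowFlow_add (s t : ℝ) (y : Y) :
    D.slowFlow (s + t) y = D.slowFlow s (D.slowFlow t y) := by
  have h : (⟨D.P (D.slowFlow t y), D.slowFlow t y, rfl⟩ : D.P.range) =
      D.group.op t ⟨D.P y, y, rfl⟩ := Subtype.ext (D.P_slowFlow t y)
  rw [slowFlow, slowFlow, h, D.group.op_add]
  rfl

theorem slowFlow_of_nonneg {t : ℝ} (ht : 0 ≤ t) (y : Y) :
    D.slowFlow t y = sp.semigroup.op t (D.P y) :=
  D.group_eq t ht _

/-- The slow flow at a fixed time, as a bounded operator on `Y`. -/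
noncomputable def slowFlowCLM (t : ℝ) : Y →L[ℝ] Y :=
  D.P.range.subtypeL.comp ((D.group.op t).comp D.P.rangeRestrict)

theorem slowFlowCLM_apply (t : ℝ) (y : Y) : D.slowFlowCLM t y = D.slowFlow t y := rfl

theorem continuous_slowFlow (y : Y) : Continuous fun t => D.slowFlow t y :=
  continuous_subtype_val.comp (D.group.continuous_orbit _)

theorem continuous_uncurry_slowFlow [CompleteSpace Y] :
    Continuous fun p : ℝ × Y => D.slowFlow p.1 p.2 := by
  rw [continuous_iff_continuousAt]
  rintro ⟨t, y⟩
  have hU : Ioi (t - 1) ×ˢ univ ∈ 𝓝 (t, y) :=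
    (isOpen_Ioi.prod isOpen_univ).mem_nhds ⟨sub_one_lt t, mem_univ _⟩
  have h1 : ContinuousOn (fun p : ℝ × Y =>
      D.slowFlowCLM (t - 1) (sp.semigroup.op (p.1 - (t - 1)) (D.P p.2))) (Ioi (t - 1) ×ˢ univ) := by
    refine (D.slowFlowCLM (t - 1)).continuous.comp_continuousOn ?_
    exact sp.semigroup.continuousOn_uncurry.comp
      (f := fun p : ℝ × Y => (p.1 - (t - 1), D.P p.2)) (by fun_prop)
      fun p hp => ⟨mem_Ici.2 (sub_pos.2 (mem_Ioi.1 hp.1)).le, mem_univ _⟩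
  refine (h1.continuousAt hU).congr ?_
  filter_upwards [hU] with p hp
  rw [← D.slowFlow_of_nonneg (sub_pos.2 hp.1).le, D.slowFlowCLM_apply, ← D.slowFlow_add]
  congr 1
  ring

theorem P_gen_of_slow {y : Y₁} (hy : D.P (sp.ι₁ y) = sp.ι₁ y) : D.P (sp.gen y) = sp.gen y := by
  obtain ⟨y', h1, h2⟩ := D.P_comm y
  rw [hy] at h1
  rw [← h2, sp.isGenerator.1 h1]

theorem gen_of_ι₁_eq_slowFlow {t : ℝ} (ht : t ≤ 0) {y y' : Y₁} (hy : D.P (sp.ι₁ y) = sp.ι₁ y)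
    (h : sp.ι₁ y' = D.slowFlow t (sp.ι₁ y)) : sp.gen y' = D.slowFlow t (sp.gen y) := by
  have hy' : D.P (sp.ι₁ y') = sp.ι₁ y' := by rw [h, P_slowFlow]
  obtain ⟨z, h1, h2⟩ := sp.isGenerator.exists_op (neg_nonneg.2 ht) y'
  rw [← hy', ← D.slowFlow_of_nonneg (neg_nonneg.2 ht), h, ← D.slowFlow_add, neg_add_cancel,
    D.slowFlow_zero, hy] at h1
  rw [sp.isGenerator.1 h1, ← D.P_gen_of_slow hy', ← D.slowFlow_of_nonneg (neg_nonneg.2 ht)] at h2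
  rw [h2, ← D.slowFlow_add, add_neg_cancel, D.slowFlow_zero, D.P_gen_of_slow hy']

theorem exists_slow_backward {y : Y₁} (hy : D.IsSlow y) {t : ℝ} (ht : t ≤ 0) :
    ∃ y' : Y₁, sp.ι₁ y' = D.slowFlow t (sp.ι₁ y) ∧ ‖y'‖ ≤ MB * Real.exp (βS * t) * ‖y‖ := by
  obtain ⟨y', h1, h2⟩ := D.bound_slow (-t) (neg_nonneg.2 ht) y hy
  have e : (⟨D.P (sp.ι₁ y), sp.ι₁ y, rfl⟩ : D.P.range) = ⟨sp.ι₁ y, hy⟩ :=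
    Subtype.ext (D.isSlow_iff.1 hy)
  refine ⟨y', ?_, by simpa using h2⟩
  rw [h1, neg_neg, slowFlow, e]

theorem exists_slowOrbit {y : Y₁} (hy : D.IsSlow y) :
    ∃ q : ℝ → Y₁, ContinuousOn q (Iic 0) ∧ ∀ t ≤ 0,
      sp.ι₁ (q t) = D.slowFlow t (sp.ι₁ y) ∧ ‖q t‖ ≤ MB * Real.exp (βS * t) * ‖y‖ := by
  choose! q hq using fun t (ht : t ≤ 0) => D.exists_slow_backward hy ht
  refine ⟨q, ?_, hq⟩
  rw [sp.isInducing_gen.continuousOn_iff]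
  exact (D.continuous_slowFlow (sp.gen y)).continuousOn.congr fun t ht =>
    D.gen_of_ι₁_eq_slowFlow ht (D.isSlow_iff.1 hy) (hq t ht).1

theorem isSlow_Q (y : Yδ) : D.IsSlow (D.Q y) := ⟨_, (D.ι₁_Q y).symm⟩

theorem exists_slowKernel (hMB : 0 ≤ MB) :
    ∃ K : ℝ → Yδ →L[ℝ] Y₁, (∀ t, t < 0 → ∀ y, sp.ι₁ (K t y) = D.slowFlow t (sp.ι y)) ∧
      (∀ t, t < 0 → ‖K t‖ ≤ MB * ‖D.Q‖ * Real.exp (βS * t)) ∧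
      ∀ y, ContinuousOn (fun t => K t y) (Iio 0) := by
  have hQ : ∀ t y, D.slowFlow t (sp.ι₁ (D.Q y)) = D.slowFlow t (sp.ι y) := fun t y => by
    rw [D.ι₁_Q, D.slowFlow_P]
  have : ∀ t, ∃ K : Yδ →L[ℝ] Y₁, t < 0 → (∀ y, sp.ι₁ (K y) = D.slowFlow t (sp.ι y)) ∧
      ‖K‖ ≤ MB * ‖D.Q‖ * Real.exp (βS * t) := fun t => by
    by_cases ht : t < 0
    · obtain ⟨G, h1, h2⟩ := exists_lift sp.isGenerator.1 ((D.slowFlowCLM t).comp sp.ι)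
        (b := MB * ‖D.Q‖ * Real.exp (βS * t)) fun y => by
          obtain ⟨y', h1, h2⟩ := D.exists_slow_backward (D.isSlow_Q y) ht.le
          refine ⟨y', h1.trans (hQ t y), h2.trans ?_⟩
          calc _ ≤ MB * Real.exp (βS * t) * (‖D.Q‖ * ‖y‖) := by gcongr; exact D.Q.le_opNorm y
            _ = _ := by ring
      exact ⟨G, fun _ => ⟨h1, G.opNorm_le_bound (by positivity) h2⟩⟩
    · exact ⟨0, fun h' => absurd h' ht⟩
  choose K hK using this
  refine ⟨K, fun t ht => (hK t ht).1, fun t ht => (hK t ht).2, fun y => ?_⟩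
  rw [sp.isInducing_gen.continuousOn_iff]
  refine (D.continuous_slowFlow (sp.gen (D.Q y))).continuousOn.congr fun t ht => ?_
  exact D.gen_of_ι₁_eq_slowFlow (le_of_lt ht) (D.isSlow_iff.1 (D.isSlow_Q y))
    (((hK t ht).1 y).trans (hQ t y).symm)

/-- As the semigroup is exponentially stable, a nontrivial slow part decays. -/
theorem slowRate_neg [CompleteSpace Y] (hD : D.P ≠ 0) (hMB : 0 ≤ MB) : βS < 0 := by
  obtain ⟨M, ω, hω, hM⟩ := sp.exp_stable
  obtain ⟨y₁, hy₁⟩ : ∃ y₁ : Y₁, D.P (sp.ι₁ y₁) ≠ 0 := by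
    by_contra! h
    refine hD (ContinuousLinearMap.coeFn_injective ?_)
    exact sp.isGenerator.denseRange.equalizer D.P.continuous continuous_const (funext h)
  obtain ⟨y, hy, -⟩ := D.P_comm y₁
  have hslow : D.IsSlow y := ⟨_, hy.symm⟩
  have hy0 : 0 < ‖y‖ := norm_pos_iff.2 fun h0 => hy₁ (by rw [← hy, h0, map_zero])
  have key : ∀ t, 0 ≤ t → 1 ≤ MB * M * Real.exp (-((βS + ω) * t)) := fun t ht => by
    obtain ⟨z, hz1, hz2⟩ := sp.isGenerator.exists_op ht y
    have hzs : sp.ι₁ z = D.slowFlow t (sp.ι₁ y) := by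
      rw [hz1, D.slowFlow_of_nonneg ht, D.isSlow_iff.1 hslow]
    have hzslow : D.IsSlow z := D.isSlow_iff.2 (by rw [hzs, P_slowFlow])
    obtain ⟨y', h1, h2⟩ := D.exists_slow_backward hzslow (neg_nonpos.2 ht)
    rw [hzs, ← D.slowFlow_add, neg_add_cancel, D.slowFlow_zero, D.isSlow_iff.1 hslow] at h1
    rw [sp.isGenerator.1 h1] at h2
    have hzn : ‖z‖ ≤ M * Real.exp (-ω * t) * ‖y‖ := by
      rw [← sp.norm_gen z, hz2, ← sp.norm_gen y]
      exact (sp.semigroup.op t).le_of_opNorm_le (hM t ht) _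
    have h3 : ‖y‖ * 1 ≤ ‖y‖ * (MB * M * Real.exp (-((βS + ω) * t))) := by
      calc ‖y‖ * 1 = ‖y‖ := mul_one _
        _ ≤ MB * Real.exp (βS * -t) * ‖z‖ := h2
        _ ≤ MB * Real.exp (βS * -t) * (M * Real.exp (-ω * t) * ‖y‖) := by gcongr
        _ = ‖y‖ * (MB * M * (Real.exp (βS * -t) * Real.exp (-ω * t))) := by ring
        _ = _ := by rw [← Real.exp_add]; ring_nf
    exact le_of_mul_le_mul_left h3 hy0
  by_contra! hcon
  have hpos : 0 < βS + ω := by linarith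
  have hlim : Tendsto (fun t : ℝ => MB * M * Real.exp (-((βS + ω) * t))) atTop (𝓝 0) := by
    have h1 : Tendsto (fun t : ℝ => (βS + ω) * t) atTop atTop :=
      tendsto_id.const_mul_atTop hpos
    simpa using (Real.tendsto_exp_neg_atTop_nhds_zero.comp h1).const_mul (MB * M)
  have := ge_of_tendsto hlim (eventually_atTop.2 ⟨0, key⟩)
  linarith

theorem P_op [CompleteSpace Y] {t : ℝ} (ht : 0 ≤ t) (y : Y) :
    D.P (sp.semigroup.op t y) = sp.semigroup.op t (D.P y) := by
  have h := sp.isGenerator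
  suffices H : ∀ z : Y₁, D.P (sp.semigroup.op t (sp.ι₁ z)) = sp.semigroup.op t (D.P (sp.ι₁ z)) from
    congrFun (h.denseRange.equalizer (g := fun y => D.P (sp.semigroup.op t y))
      (h := fun y => sp.semigroup.op t (D.P y)) (by fun_prop) (by fun_prop) (funext H)) y
  intro z
  choose p hp₁ hp₂ using D.P_comm
  have key := h.variation_of_constants (T := t) (y := fun s => p (h.domainOp s z))
    (φ := fun _ => 0) continuousOn_const (fun s hs => ?_) (right_mem_Icc.2 ht)
  · simpa [hp₁, h.ι_domainOp ht, h.domainOp_zero] using key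
  · have hd : HasDerivWithinAt (fun r => sp.semigroup.op r (sp.ι₁ z))
        (sp.semigroup.op s (sp.gen z)) (Icc 0 t) s := by
      rcases hs.1.eq_or_lt with rfl | h0
      · exact (h.hasDerivWithinAt_orbit le_rfl z).Ici_of_Ioi.mono Icc_subset_Ici_self
      · exact (h.hasDerivAt_orbit h0 z).hasDerivWithinAt
    rw [add_zero, hp₂, h.A_domainOp hs.1]
    refine (D.P.hasFDerivAt.comp_hasDerivWithinAt s hd).congr_of_mem (fun r hr => ?_) hs
    rw [hp₁, h.ι_domainOp hr.1]; rfl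

theorem P_ι_prF (y : Yδ) : D.P (sp.ι (D.prF y)) = 0 := by
  simp [prF, sp.ι_κ, D.ι₁_Q, D.P_idem]

/-- The semigroup on `Y_F ∩ Y₁` is bounded by a multiple of `e^{ηt}` when `βF ≤ η ≤ 0`. -/
theorem exists_fast_bound (hδ : δ ≤ 1) (hCB : 0 ≤ CB) {η : ℝ} (hη : βF ≤ η)
    (hη0 : η ≤ 0) :
    ∃ c, 0 ≤ c ∧ ∀ y, D.IsFast y → ∀ t, 0 ≤ t →
      ‖sp.isGenerator.domainOp t y‖ ≤ c * Real.exp (η * t) * ‖y‖ := by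
  obtain ⟨M, ω, hω, hM⟩ := sp.exp_stable
  have hM0 : 0 ≤ M := by simpa using (norm_nonneg _).trans (hM 0 le_rfl)
  refine ⟨M * Real.exp (-η) + CB * ‖sp.κ‖, by positivity, fun y hy t ht => ?_⟩
  rw [add_mul, add_mul]
  rcases le_total t 1 with h1 | h1
  · refine le_add_of_le_of_nonneg ?_ (by positivity)
    rw [← sp.norm_gen, sp.isGenerator.A_domainOp ht, ← sp.norm_gen y]
    refine ((sp.semigroup.op t).le_of_opNorm_le (hM t ht) _).trans ?_
    rw [mul_assoc M (Real.exp (-η)), ← Real.exp_add]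
    gcongr
    nlinarith
  · refine le_add_of_nonneg_of_le (by positivity) ?_
    obtain ⟨y', hy', hb⟩ := D.bound_fast t (by linarith) (sp.κ y) (by rw [sp.ι_κ]; exact hy)
    have : sp.isGenerator.domainOp t y = y' :=
      sp.isGenerator.1 (by rw [sp.isGenerator.ι_domainOp ht, hy', sp.ι_κ])
    rw [this]
    refine hb.trans ?_
    have h2 : t ^ (δ - 1) ≤ 1 := Real.rpow_le_one_of_one_le_of_nonpos h1 (by linarith)
    calc _ ≤ CB * 1 * Real.exp (η * t) * (‖sp.κ‖ * ‖y‖) := by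
          gcongr
          exact sp.κ.le_opNorm y
      _ = _ := by ring

end Splitting

end

/-- The state space `X₁ × Y₁ × Y₁`, normed by the sum of the three norms. -/
abbrev SumState (X₁ Y₁ : Type*) [NormedAddCommGroup X₁] [NormedAddCommGroup Y₁] : Type _ :=
  WithLp 1 (X₁ × WithLp 1 (Y₁ × Y₁))

namespace SumState

variable {X₁ Y₁ : Type*} [NormedAddCommGroup X₁] [NormedAddCommGroup Y₁]

/-- A triple, as an element of the state space. -/
def mk (u : X₁) (v v' : Y₁) : SumState X₁ Y₁ := WithLp.toLp 1 (u, WithLp.toLp 1 (v, v'))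

theorem mk_eta (x : SumState X₁ Y₁) : mk x.fst x.snd.fst x.snd.snd = x := rfl

theorem norm_eq (x : SumState X₁ Y₁) : ‖x‖ = ‖x.fst‖ + ‖x.snd.fst‖ + ‖x.snd.snd‖ := by
  rw [WithLp.prod_norm_eq_of_L1, WithLp.prod_norm_eq_of_L1, add_assoc]

theorem norm_mk (u : X₁) (v v' : Y₁) : ‖mk u v v'‖ = ‖u‖ + ‖v‖ + ‖v'‖ := norm_eq _

theorem mk_add (u u₂ : X₁) (v v₂ v' v₂' : Y₁) :
    mk u v v' + mk u₂ v₂ v₂' = mk (u + u₂) (v + v₂) (v' + v₂') := rfl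

theorem mk_sub (u u₂ : X₁) (v v₂ v' v₂' : Y₁) :
    mk u v v' - mk u₂ v₂ v₂' = mk (u - u₂) (v - v₂) (v' - v₂') := rfl

theorem mk_inj {u u₂ : X₁} {v v₂ v' v₂' : Y₁} (h : mk u v v' = mk u₂ v₂ v₂') :
    u = u₂ ∧ v = v₂ ∧ v' = v₂' :=
  ⟨congrArg (fun x => x.fst) h, congrArg (fun x => x.snd.fst) h, congrArg (fun x => x.snd.snd) h⟩

theorem eq_mk_add_iff {u : X₁} {v v' q : Y₁} {x : SumState X₁ Y₁} :
    mk u v v' = mk 0 0 q + x ↔ u = x.fst ∧ v = x.snd.fst ∧ v' = q + x.snd.snd := by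
  constructor
  · intro h
    have h2 := mk_inj (h.trans (by rw [← mk_eta x, mk_add]))
    simpa using h2
  · rintro ⟨rfl, rfl, rfl⟩
    rw [← mk_eta x, mk_add, zero_add, zero_add]
    rfl

theorem continuous_mk : Continuous fun p : X₁ × Y₁ × Y₁ => mk p.1 p.2.1 p.2.2 :=
  (WithLp.prod_continuous_toLp 1 _ _).comp (continuous_fst.prodMk
    ((WithLp.prod_continuous_toLp 1 _ _).comp continuous_snd))

theorem lipschitz_comp {V : Type*} [NormedAddCommGroup V] {φ : X₁ × Y₁ → V} {l : ℝ}
    (hl : 0 ≤ l)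
    (h : ∀ x₁ x₂ y₁ y₂, ‖φ (x₁, y₁) - φ (x₂, y₂)‖ ≤ l * (‖x₁ - x₂‖ + ‖y₁ - y₂‖))
    (x y : SumState X₁ Y₁) :
    ‖φ (x.fst, x.snd.fst + x.snd.snd) - φ (y.fst, y.snd.fst + y.snd.snd)‖ ≤ l * ‖x - y‖ := by
  refine (h _ _ _ _).trans (mul_le_mul_of_nonneg_left ?_ hl)
  rw [norm_eq, add_assoc, add_sub_add_comm]
  exact add_le_add_right (norm_add_le _ _) _

theorem continuous_fst_sum :
    Continuous fun x : SumState X₁ Y₁ => (x.fst, x.snd.fst + x.snd.snd) := by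
  have hsnd : Continuous fun y : SumState X₁ Y₁ => y.snd := WithLp.continuous_snd 1 _ _
  exact (WithLp.continuous_fst 1 _ _).prodMk (((WithLp.continuous_fst 1 _ _).comp hsnd).add
    ((WithLp.continuous_snd 1 _ _).comp hsnd))

theorem isWeightedLipschitz_conv [NormedSpace ℝ X₁] [NormedSpace ℝ Y₁]
    {H₁ : ℝ → SumState X₁ Y₁ → X₁}
    {H₂ H₃ : ℝ → SumState X₁ Y₁ → Y₁} {k₁ k₂ k₃ : ℝ → ℝ} {η L₁ L₂ L₃ : ℝ}
    (h₁ : IsGreenKernel H₁ k₁ η L₁) (h₂ : IsGreenKernel H₂ k₂ η L₂)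
    (h₃ : IsGreenKernel H₃ k₃ η L₃) :
    IsWeightedLipschitz (fun w t => mk (conv H₁ w t) (conv H₂ w t) (conv H₃ w t)) η
      (L₁ + L₂ + L₃) where
  nonneg := add_nonneg (add_nonneg h₁.L_nonneg h₂.L_nonneg) h₃.L_nonneg
  map_zero t := by rw [h₁.conv_zero, h₂.conv_zero, h₃.conv_zero]; rfl
  continuousOn w hw := (continuous_mk.comp ((h₁.continuous_conv hw).prodMk
    ((h₂.continuous_conv hw).prodMk (h₃.continuous_conv hw)))).continuousOn
  lipschitz w w' hw hw' D hD hd t _ := by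
    rw [mk_sub, norm_mk, add_mul, add_mul, add_mul, add_mul]
    exact add_le_add (add_le_add (h₁.norm_conv_sub_le hw hw' hD hd t)
      (h₂.norm_conv_sub_le hw hw' hD hd t)) (h₃.norm_conv_sub_le hw hw' hD hd t)

end SumState

section

variable {X X₁ Xγ Y Y₁ Yδ : Type*}
  [NormedAddCommGroup X] [NormedSpace ℝ X] [NormedAddCommGroup X₁] [NormedSpace ℝ X₁]
  [NormedAddCommGroup Xγ] [NormedSpace ℝ Xγ]
  [NormedAddCommGroup Y] [NormedSpace ℝ Y] [NormedAddCommGroup Y₁] [NormedSpace ℝ Y₁]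
  [NormedAddCommGroup Yδ] [NormedSpace ℝ Yδ]

/-- `ε⁻¹ f̃`, with values in `X`. -/
noncomputable def System.forceX (S : System X X₁ Xγ Y Y₁ Yδ) (ε : ℝ) (x : SumState X₁ Y₁) : X :=
  ε⁻¹ • S.spX.ι (S.fMod (x.fst, x.snd.fst + x.snd.snd))

/-- `g`, with values in `Yδ`. -/
noncomputable def System.gSum (S : System X X₁ Xγ Y Y₁ Yδ) (x : SumState X₁ Y₁) : Yδ :=
  S.g (x.fst, x.snd.fst + x.snd.snd)

theorem System.fMod_zero (S : System X X₁ Xγ Y Y₁ Yδ) : S.fMod (0, 0) = 0 := by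
  simp [System.fMod, S.f_zero]

/-- The Lyapunov–Perron operator, in `X₁ × Y₁ × Y₁`. -/
structure IsLyapunovPerron (S : System X X₁ Xγ Y Y₁ Yδ) {ε γ μ M C : ℝ} (hε : 0 < ε)
    (E : ModifiedSemigroup S ε γ μ M C) {δ βF βS CB MB : ℝ}
    (D : Splitting S.spY δ βF βS CB MB) (η L : ℝ)
    (Φ : (ℝ → SumState X₁ Y₁) → ℝ → SumState X₁ Y₁) : Prop where
  lipschitz : IsWeightedLipschitz Φ η L
  lt_one : L < 1
  integrable_fst : ∀ w, Admissible η w → ∀ t ≤ 0, IntegrableOn (fun s =>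
    (E.semigroup.rescale ε⁻¹ (inv_pos.2 hε)).op (t - s) (S.forceX ε (w s))) (Iic t)
  fst_eq : ∀ w, Admissible η w → ∀ t ≤ 0, S.spX.ι₁ (Φ w t).fst = ∫ s in Iic t,
    (E.semigroup.rescale ε⁻¹ (inv_pos.2 hε)).op (t - s) (S.forceX ε (w s))
  integrable_fast : ∀ w, Admissible η w → ∀ t ≤ 0, IntegrableOn (fun s =>
    S.spY.semigroup.op (t - s) (S.spY.ι (D.prF (S.gSum (w s))))) (Iic t)
  fast_eq : ∀ w, Admissible η w → ∀ t ≤ 0, S.spY.ι₁ (Φ w t).snd.fst = ∫ s in Iic t,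
    S.spY.semigroup.op (t - s) (S.spY.ι (D.prF (S.gSum (w s))))
  slow_eq : ∀ w, Admissible η w → ∀ t ≤ 0, S.spY.ι₁ (Φ w t).snd.snd = ∫ s in (0 : ℝ)..t,
    D.slowFlow (t - s) (S.spY.ι (S.gSum (w s)))
  isFast : ∀ w, Admissible η w → ∀ t, D.IsFast (Φ w t).snd.fst
  isSlow : ∀ w, Admissible η w → ∀ t, D.IsSlow (Φ w t).snd.snd

theorem exists_isLyapunovPerron [CompleteSpace X] [CompleteSpace X₁] [CompleteSpace Y]
    [CompleteSpace Y₁] (S : System X X₁ Xγ Y Y₁ Yδ) {γ δ : ℝ} (hγ : γ ∈ Ioc (0 : ℝ) 1)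
    (hδ : δ ∈ Ioc (0 : ℝ) 1) {μ MA CA MB CB Lf Lg NF NS : ℝ} (hCA : 0 < CA)
    (hMB : 0 < MB) (hCB : 0 < CB) (hLf : 0 ≤ Lf) (hLg : 0 ≤ Lg) (hNF : 0 ≤ NF) (hN : NF < NS)
    (hf : ∀ (x₁ x₂ : X₁) (y₁ y₂ : Y₁),
      ‖S.fMod (x₁, y₁) - S.fMod (x₂, y₂)‖ ≤ Lf * (‖x₁ - x₂‖ + ‖y₁ - y₂‖))
    (hg : ∀ (x₁ x₂ : X₁) (y₁ y₂ : Y₁),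
      ‖S.g (x₁, y₁) - S.g (x₂, y₂)‖ ≤ Lg * (‖x₁ - x₂‖ + ‖y₁ - y₂‖))
    {ε ζ : ℝ} (hε : 0 < ε) (hεζ : ε * ζ⁻¹ < 1) (hμ : μ < 0)
    (E : ModifiedSemigroup S ε γ μ MA CA)
    (D : Splitting S.spY δ (NF + ζ⁻¹ * μ) (NS + ζ⁻¹ * μ) CB MB)
    (hL : gapConst ε ζ μ γ δ Lf Lg CA CB MB NF NS ‖D.prF‖ ‖D.Q‖ < 1)
    {η : ℝ} (hη : η = ζ⁻¹ * μ + (NS + NF) / 2) :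
    ∃ L Φ, IsLyapunovPerron S hε E D η L Φ := by
  have hεi : 0 < ε⁻¹ := inv_pos.2 hε
  have hrate : 2 * (ε * ζ⁻¹ - 1) * μ + ε * (NS + NF) = 2 * ε * (η - μ * ε⁻¹) := by
    rw [hη]; field_simp; ring
  have hrate0 : 0 < η - μ * ε⁻¹ := by
    have h1 : 0 < (1 - ε * ζ⁻¹) * (-μ) := mul_pos (sub_pos.2 hεζ) (neg_pos.2 hμ)
    have h2 : 0 < ε * (NS + NF) := mul_pos hε (by linarith)
    have h3 : 0 < 2 * ε * (η - μ * ε⁻¹) := by rw [← hrate]; linarith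
    exact pos_of_mul_pos_right h3 (by positivity)
  have hdF : η - (NF + ζ⁻¹ * μ) = (NS - NF) / 2 := by rw [hη]; ring
  have hdS : NS + ζ⁻¹ * μ - η = (NS - NF) / 2 := by rw [hη]; ring
  have hNSF : 0 < NS - NF := sub_pos.2 hN
  obtain ⟨K₁, hK₁, hK₁b, hK₁c⟩ := (E.isGenerator.rescale hεi).exists_smoothing S.spX.ι
    (b := fun t => CA * (ε⁻¹ * t) ^ (γ - 1) * Real.exp (μ * (ε⁻¹ * t)))
    (fun t ht => by positivity) (fun t ht v => E.bound_smoothing _ (mul_pos hεi ht) v)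
  obtain ⟨K₂, hK₂, hK₂b, hK₂c⟩ := S.spY.isGenerator.exists_smoothing (S.spY.ι.comp D.prF)
    (b := fun t => CB * ‖D.prF‖ * t ^ (δ - 1) * Real.exp ((NF + ζ⁻¹ * μ) * t))
    (fun t ht => by positivity) (fun t ht v => by
      obtain ⟨z, h1, h2⟩ := D.bound_fast t ht (D.prF v) (D.P_ι_prF v)
      refine ⟨z, h1, h2.trans ?_⟩
      calc _ ≤ CB * t ^ (δ - 1) * Real.exp ((NF + ζ⁻¹ * μ) * t) * (‖D.prF‖ * ‖v‖) := by
            gcongr; exact D.prF.le_opNorm v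
        _ = _ := by ring)
  obtain ⟨K₃, hK₃, hK₃b, hK₃c⟩ := D.exists_slowKernel hMB.le
  have hf₀ := SumState.lipschitz_comp hLf hf
  have hg₀ : ∀ x y, ‖S.gSum x - S.gSum y‖ ≤ Lg * ‖x - y‖ := SumState.lipschitz_comp hLg hg
  have hg00 : S.gSum 0 = 0 := by
    have : S.gSum 0 = S.g (0, 0) := by simp [System.gSum]
    rw [this, S.g_zero]
  have h₁ := isGreenKernel_fast (K := K₁) (a := γ) (β := μ * ε⁻¹) (η := η) (l := ε⁻¹ * Lf)
    (C := CA * ε⁻¹ ^ (γ - 1))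
    (N := fun x : SumState X₁ Y₁ => ε⁻¹ • S.fMod (x.fst, x.snd.fst + x.snd.snd))
    (fun x y => by
      rw [← smul_sub, norm_smul, Real.norm_of_nonneg hεi.le, mul_assoc]
      exact mul_le_mul_of_nonneg_left (hf₀ x y) hεi.le)
    (by simp [S.fMod_zero]) (by positivity) (by positivity) hγ.1 (by linarith)
    (fun r hr => (hK₁b r hr).trans (le_of_eq (by
      rw [Real.mul_rpow hεi.le hr.le]; ring_nf))) hK₁c
  have h₂ := isGreenKernel_fast (K := K₂) (a := δ) (β := NF + ζ⁻¹ * μ) (η := η) (l := Lg)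
    (C := CB * ‖D.prF‖) (N := S.gSum) hg₀ hg00 hLg (by positivity) hδ.1 (by linarith) hK₂b hK₂c
  have h₃ := isGreenKernel_slow (K := K₃) (β := NS + ζ⁻¹ * μ) (η := η) (l := Lg)
    (C := MB * ‖D.Q‖) (N := S.gSum) hg₀ hg00 hLg (by positivity) (by linarith) hK₃b hK₃c
  refine ⟨_, _, SumState.isWeightedLipschitz_conv h₁ h₂ h₃, ?_, ?_, ?_, ?_, ?_, ?_, ?_, ?_⟩
  · refine lt_of_le_of_lt ?_ hL
    unfold gapConst
    refine add_le_add (add_le_add (le_of_eq ?_) (le_of_eq ?_)) ?_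
    · rw [hrate, Real.mul_rpow (by positivity) hrate0.le, Real.mul_rpow zero_le_two hε.le]
      have e1 : ε⁻¹ * ε⁻¹ ^ (γ - 1) = (ε ^ γ)⁻¹ := by
        rw [← Real.inv_rpow hε.le, Real.rpow_sub_one hεi.ne']
        field_simp
      have h2 : (2 : ℝ) ^ γ ≠ 0 := (Real.rpow_pos_of_pos two_pos γ).ne'
      have h3 : ε ^ γ ≠ 0 := (Real.rpow_pos_of_pos hε γ).ne'
      have h4 : (η - μ * ε⁻¹) ^ γ ≠ 0 := (Real.rpow_pos_of_pos hrate0 γ).ne'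
      calc _ = Lf * CA * Real.Gamma γ * (ε⁻¹ * ε⁻¹ ^ (γ - 1)) / (η - μ * ε⁻¹) ^ γ := by ring
        _ = _ := by rw [e1]; field_simp
    · rw [hdF, Real.div_rpow hNSF.le zero_le_two]
      have h2 : (2 : ℝ) ^ δ ≠ 0 := (Real.rpow_pos_of_pos two_pos δ).ne'
      field_simp
    · rw [hdS]
      have hG := one_le_Gamma_of_mem_Ioc hδ
      have h0 : 0 ≤ 2 * (Lg * ‖D.Q‖) * MB := by positivity
      calc _ = 2 * (Lg * ‖D.Q‖) * MB * 1 / (NS - NF) := by field_simp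
        _ ≤ _ := by gcongr
  · exact fun w hw t ht => (map_conv_fast h₁ S.spX.ι₁ (F := fun r v =>
      (E.semigroup.rescale ε⁻¹ hεi).op r (S.spX.ι v)) hK₁ hw ht).1.congr_fun
      (fun s _ => by simp only [System.forceX, map_smul]) measurableSet_Iic
  · intro w hw t ht
    refine (map_conv_fast h₁ S.spX.ι₁ (F := fun r v =>
      (E.semigroup.rescale ε⁻¹ hεi).op r (S.spX.ι v)) hK₁ hw ht).2.trans ?_
    simp only [System.forceX, map_smul]
  · exact fun w hw t ht => (map_conv_fast h₂ S.spY.ι₁ (F := fun r v =>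
      S.spY.semigroup.op r (S.spY.ι (D.prF v))) hK₂ hw ht).1
  · exact fun w hw t ht => (map_conv_fast h₂ S.spY.ι₁ (F := fun r v =>
      S.spY.semigroup.op r (S.spY.ι (D.prF v))) hK₂ hw ht).2
  · exact fun w hw t ht => map_conv_slow h₃ S.spY.ι₁ (F := fun r v =>
      D.slowFlow r (S.spY.ι v)) hK₃ hw ht
  · refine fun w hw t => h₂.map_conv_eq_zero hw (j := D.P.comp S.spY.ι₁) (fun r x => ?_) t
    split_ifs with hr
    · rw [ContinuousLinearMap.comp_apply, hK₂ r hr, D.P_op hr.le]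
      simp [D.P_ι_prF]
    · rw [map_zero]
  · refine fun w hw t => D.isSlow_iff.2 (sub_eq_zero.1 ?_)
    refine h₃.map_conv_eq_zero hw (j := D.P.comp S.spY.ι₁ - S.spY.ι₁) (fun r x => ?_) t
    split_ifs with hr
    · simp [hK₃ r hr, D.P_slowFlow]
    · rw [map_zero]

end

theorem setIntegral_Iic_add_right {Z : Type*} [NormedAddCommGroup Z] [NormedSpace ℝ Z]
    (F : ℝ → Z) (s t : ℝ) : ∫ q in Iic s, F (q + t) = ∫ q in Iic (s + t), F q := by
  have h := (measurePreserving_add_right volume t).setIntegral_preimage_emb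
    (measurableEmbedding_addRight t) F (Iic (s + t))
  rw [← h]
  congr 2
  ext q
  simp

/-- A mild solution on `[0, t]`, preceded by a convolution over `(-∞, 0]` and shifted by `t`. -/
theorem C0Semigroup.concat_eq {X : Type*} [NormedAddCommGroup X] [NormedSpace ℝ X]
    [CompleteSpace X] (R : C0Semigroup X) {t s : ℝ} (hs : s ∈ Icc (-t) 0) {ψ ψ₀ φ : ℝ → X}
    (h₀ : ∀ q ≤ -t, ψ q = ψ₀ (q + t)) (hφ : ∀ q ∈ Ioc (-t) 0, ψ q = φ (q + t))
    (hi₀ : IntegrableOn (fun q => R.op (-t - q) (ψ q)) (Iic (-t)))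
    (hi : IntegrableOn (fun q => R.op (s - q) (ψ q)) (Iic s)) {x a : X}
    (ha : a = ∫ q in Iic (0 : ℝ), R.op (0 - q) (ψ₀ q)) :
    R.op (s + t) x + ∫ q in (0 : ℝ)..(s + t), R.op (s + t - q) (φ q) =
      R.op (s + t) (x - a) + ∫ q in Iic s, R.op (s - q) (ψ q) := by
  have hst : 0 ≤ s + t := by linarith [hs.1]
  have e0 : a = ∫ q in Iic (-t), R.op (-t - q) (ψ q) := by
    rw [ha, ← neg_add_cancel t, ← setIntegral_Iic_add_right]
    refine setIntegral_congr_fun measurableSet_Iic fun q hq => ?_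
    rw [h₀ q hq]
    congr 2
    ring
  have e1 : R.op (s + t) a = ∫ q in Iic (-t), R.op (s - q) (ψ q) := by
    rw [e0, ← ContinuousLinearMap.integral_comp_comm _ hi₀]
    refine setIntegral_congr_fun measurableSet_Iic fun q hq => ?_
    rw [← R.op_add_apply hst (sub_nonneg.2 hq)]
    congr 2
    ring
  have e2 : ∫ q in (0 : ℝ)..(s + t), R.op (s + t - q) (φ q) =
      ∫ q in (-t)..s, R.op (s - q) (ψ q) := by
    rw [← neg_add_cancel t,
      ← intervalIntegral.integral_comp_add_right (fun q => R.op (s + t - q) (φ q))]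
    refine intervalIntegral.integral_congr_ae (Eventually.of_forall fun q hq => ?_)
    rw [uIoc_of_le hs.1] at hq
    rw [hφ q ⟨hq.1, hq.2.trans hs.2⟩]
    congr 2
    ring
  have e3 : (∫ q in Iic (-t), R.op (s - q) (ψ q)) + ∫ q in (-t)..s, R.op (s - q) (ψ q) =
      ∫ q in Iic s, R.op (s - q) (ψ q) := by
    rw [← intervalIntegral.integral_Iic_sub_Iic (hi.mono_set (Iic_subset_Iic.2 hs.1)) hi]
    abel
  rw [map_sub, e1, e2, ← e3]
  abel

namespace Splitting

variable {Y Y₁ Yδ : Type*} [NormedAddCommGroup Y] [NormedSpace ℝ Y] [CompleteSpace Y]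
  [NormedAddCommGroup Y₁] [NormedSpace ℝ Y₁] [NormedAddCommGroup Yδ] [NormedSpace ℝ Yδ]
  {sp : Scale Y Y₁ Yδ} {δ βF βS CB MB : ℝ} (D : Splitting sp δ βF βS CB MB)

theorem continuousOn_slowFlow_conv {Γ : ℝ → Y} {U : Set ℝ} (hΓ : ContinuousOn Γ U) (r : ℝ) :
    ContinuousOn (fun q => D.slowFlow (r - q) (Γ q)) U :=
  D.continuous_uncurry_slowFlow.comp_continuousOn (f := fun q => (r - q, Γ q))
    ((by fun_prop : ContinuousOn (fun q => r - q) U).prodMk hΓ)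

theorem slowFlow_mild {t : ℝ} (ht : 0 ≤ t) {Γ : ℝ → Y} (hΓ : ContinuousOn Γ (Icc 0 t))
    {a b : Y} (hb : b = D.slowFlow t a + ∫ q in (0 : ℝ)..t, D.slowFlow (t - q) (Γ q)) (s : ℝ) :
    D.slowFlow s b =
      D.slowFlow (s + t) a + ∫ q in (0 : ℝ)..t, D.slowFlow (s + t - q) (Γ q) := by
  rw [hb, ← D.slowFlowCLM_apply s, map_add, D.slowFlowCLM_apply, ← D.slowFlow_add,
    ← ContinuousLinearMap.intervalIntegral_comp_comm _
      ((D.continuousOn_slowFlow_conv hΓ t).intervalIntegrable_of_Icc ht)]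
  simp only [D.slowFlowCLM_apply, ← D.slowFlow_add, add_sub_assoc]

theorem slow_concat_right {t s : ℝ} (hs : s ∈ Icc (-t) 0) {G Γ : ℝ → Y}
    (hΓ : ContinuousOn Γ (Icc 0 t)) (hG : ∀ q ∈ Ioc (-t) 0, G q = Γ (q + t)) {a b : Y}
    (hb : b = D.slowFlow t a + ∫ q in (0 : ℝ)..t, D.slowFlow (t - q) (Γ q)) :
    D.slowFlow s b + ∫ q in (0 : ℝ)..s, D.slowFlow (s - q) (G q) =
      D.slowFlow (s + t) a + ∫ q in (0 : ℝ)..(s + t), D.slowFlow (s + t - q) (Γ q) := by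
  have hst : 0 ≤ s + t := by linarith [hs.1]
  have hst' : s + t ≤ t := by linarith [hs.2]
  have hc := D.continuousOn_slowFlow_conv hΓ (s + t)
  have e1 : ∫ q in (0 : ℝ)..s, D.slowFlow (s - q) (G q) =
      ∫ q in t..(s + t), D.slowFlow (s + t - q) (Γ q) := by
    have := intervalIntegral.integral_comp_add_right (a := 0) (b := s)
      (fun q => D.slowFlow (s + t - q) (Γ q)) t
    rw [zero_add] at this
    rw [← this]
    refine intervalIntegral.integral_congr_ae (Eventually.of_forall fun q hq => ?_)
    rw [uIoc_of_ge hs.2] at hq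
    rw [hG q ⟨hs.1.trans_lt hq.1, hq.2⟩, add_sub_add_right_eq_sub]
  rw [D.slowFlow_mild (hst.trans hst') hΓ hb s, e1, add_assoc,
    intervalIntegral.integral_add_adjacent_intervals]
  · exact hc.intervalIntegrable_of_Icc (hst.trans hst')
  · exact ((hc.mono (Icc_subset_Icc_left hst)).intervalIntegrable_of_Icc hst').symm

theorem slow_concat_left {t s : ℝ} (ht : 0 ≤ t) (hs : s ≤ -t) {G G₀ Γ : ℝ → Y}
    (hG₀c : ContinuousOn G₀ (Iic 0)) (hΓ : ContinuousOn Γ (Icc 0 t))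
    (hG₀ : ∀ q ≤ -t, G q = G₀ (q + t)) (hG : ∀ q ∈ Ioc (-t) 0, G q = Γ (q + t)) {a b : Y}
    (hb : b = D.slowFlow t a + ∫ q in (0 : ℝ)..t, D.slowFlow (t - q) (Γ q)) :
    D.slowFlow s b + ∫ q in (0 : ℝ)..s, D.slowFlow (s - q) (G q) =
      D.slowFlow (s + t) a + ∫ q in (0 : ℝ)..(s + t), D.slowFlow (s + t - q) (G₀ q) := by
  have hnt : -t ≤ 0 := neg_nonpos.2 ht
  have i1 : IntervalIntegrable (fun q => D.slowFlow (s - q) (G q)) volume 0 (-t) := by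
    refine IntervalIntegrable.congr (f := fun q => D.slowFlow (s - q) (Γ (q + t))) ?_ ?_
    · intro q hq
      rw [uIoc_of_ge hnt] at hq
      simp only [hG q hq]
    · refine ContinuousOn.intervalIntegrable ?_
      rw [uIcc_of_ge hnt]
      exact D.continuousOn_slowFlow_conv (hΓ.comp (f := fun q => q + t) (by fun_prop)
        fun q hq => ⟨by linarith [hq.1], by linarith [hq.2]⟩) s
  have i2 : IntervalIntegrable (fun q => D.slowFlow (s - q) (G q)) volume (-t) s := by
    refine ContinuousOn.intervalIntegrable ?_
    rw [uIcc_of_ge hs]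
    refine D.continuousOn_slowFlow_conv ((hG₀c.comp (f := fun q => q + t) (by fun_prop)
      fun q hq => ?_).congr fun q hq => hG₀ q hq.2) s
    have := hq.2
    simp only [mem_Iic]
    linarith
  have e1 : ∫ q in (0 : ℝ)..(-t), D.slowFlow (s - q) (G q) =
      ∫ q in t..0, D.slowFlow (s + t - q) (Γ q) := by
    have := intervalIntegral.integral_comp_add_right (a := 0) (b := -t)
      (fun q => D.slowFlow (s + t - q) (Γ q)) t
    rw [zero_add, neg_add_cancel] at this
    rw [← this]
    refine intervalIntegral.integral_congr_ae (Eventually.of_forall fun q hq => ?_)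
    rw [uIoc_of_ge hnt] at hq
    rw [hG q hq, add_sub_add_right_eq_sub]
  have e2 : ∫ q in (-t)..s, D.slowFlow (s - q) (G q) =
      ∫ q in (0 : ℝ)..(s + t), D.slowFlow (s + t - q) (G₀ q) := by
    have := intervalIntegral.integral_comp_add_right (a := -t) (b := s)
      (fun q => D.slowFlow (s + t - q) (G₀ q)) t
    rw [neg_add_cancel] at this
    rw [← this]
    refine intervalIntegral.integral_congr_ae (Eventually.of_forall fun q hq => ?_)
    rw [uIoc_of_ge hs] at hq
    rw [hG₀ q hq.2, add_sub_add_right_eq_sub]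
  rw [D.slowFlow_mild ht hΓ hb s, ← intervalIntegral.integral_add_adjacent_intervals i1 i2, e1, e2,
    intervalIntegral.integral_symm 0 t]
  abel

end Splitting

/-- A curve in `X₁ × Y₁ × Y₁`, with the sum norm. -/
def sumCurve {X₁ Y₁ : Type*} [NormedAddCommGroup X₁] [NormedAddCommGroup Y₁] (w : ℝ → X₁ × Y₁ × Y₁) (t : ℝ) : SumState X₁ Y₁ :=
  SumState.mk (w t).1 (w t).2.1 (w t).2.2

theorem admissible_of_mem_weightedSpace {X₁ Y Y₁ Yδ : Type*}
    [NormedAddCommGroup X₁] [NormedAddCommGroup Y] [NormedSpace ℝ Y]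
    [NormedAddCommGroup Y₁] [NormedSpace ℝ Y₁] [NormedAddCommGroup Yδ] [NormedSpace ℝ Yδ]
    {sp : Scale Y Y₁ Yδ} {δ βF βS CB MB : ℝ}
    {D : Splitting sp δ βF βS CB MB} {η : ℝ} {w : ℝ → X₁ × Y₁ × Y₁}
    (hw : w ∈ weightedSpace X₁ D η) :
    ContinuousOn (sumCurve w) (Iic 0) ∧ ∃ K, ∀ t ≤ 0, ‖sumCurve w t‖ ≤ K * Real.exp (η * t) := by
  obtain ⟨hc, -, K, hK⟩ := hw
  refine ⟨SumState.continuous_mk.comp_continuousOn hc, K, fun t ht => ?_⟩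
  have h := mul_le_mul_of_nonneg_right (hK t ht) (Real.exp_pos (η * t)).le
  rw [mul_right_comm, ← Real.exp_add, neg_mul, neg_add_cancel, Real.exp_zero, one_mul] at h
  rwa [sumCurve, SumState.norm_mk]

section

variable {X X₁ Xγ Y Y₁ Yδ : Type*}
  [NormedAddCommGroup X] [NormedSpace ℝ X] [NormedAddCommGroup X₁] [NormedSpace ℝ X₁]
  [NormedAddCommGroup Xγ] [NormedSpace ℝ Xγ]
  [NormedAddCommGroup Y] [NormedSpace ℝ Y] [NormedAddCommGroup Y₁] [NormedSpace ℝ Y₁]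
  [NormedAddCommGroup Yδ] [NormedSpace ℝ Yδ]

theorem System.rescale_forceX (S : System X X₁ Xγ Y Y₁ Yδ) {ε γ μ M C : ℝ} (hε : 0 < ε)
    (E : ModifiedSemigroup S ε γ μ M C) (w : ℝ → X₁ × Y₁ × Y₁) (t : ℝ) :
    ∫ s in Iic t, (E.semigroup.rescale ε⁻¹ (inv_pos.2 hε)).op (t - s)
      (S.forceX ε (sumCurve w s)) =
    ε⁻¹ • ∫ s in Iic t, E.semigroup.op (ε⁻¹ * (t - s))
        (S.spX.ι (S.fMod ((w s).1, (w s).2.1 + (w s).2.2))) := by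
  rw [← integral_smul]
  simp only [System.forceX, map_smul]
  rfl

namespace IsLyapunovPerron

variable {S : System X X₁ Xγ Y Y₁ Yδ} {ε γ μ M C : ℝ} {hε : 0 < ε}
  {E : ModifiedSemigroup S ε γ μ M C} {δ βF βS CB MB : ℝ}
  {D : Splitting S.spY δ βF βS CB MB} {η L : ℝ}
  {Φ : (ℝ → SumState X₁ Y₁) → ℝ → SumState X₁ Y₁}

theorem isFixedPoint_iff (h : IsLyapunovPerron S hε E D η L Φ) {w : ℝ → X₁ × Y₁ × Y₁}
    (hw : Admissible η (sumCurve w)) {y₀ : Y₁} {q : ℝ → Y₁}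
    (hq : ∀ t ≤ 0, S.spY.ι₁ (q t) = D.slowFlow t (S.spY.ι₁ y₀)) :
    IsFixedPoint S E D y₀ w ↔
      ∀ t ≤ 0, sumCurve w t = SumState.mk 0 0 (q t) + Φ (sumCurve w) t := by
  refine forall₂_congr fun t ht => ?_
  rw [sumCurve, SumState.eq_mk_add_iff, ← S.rescale_forceX hε, ← h.fst_eq _ hw t ht, ← hq t ht,
    S.spX.isGenerator.1.eq_iff]
  refine and_congr_right fun _ => ?_
  have h2' : S.spY.ι₁ (Φ (sumCurve w) t).snd.fst = ∫ s in Iic t, S.spY.semigroup.op (t - s)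
    (S.spY.ι (D.prF (S.g ((w s).1, (w s).2.1 + (w s).2.2)))) :=
    h.fast_eq _ hw t ht
  have h3' : S.spY.ι₁ (Φ (sumCurve w) t).snd.snd = ∫ s in (0 : ℝ)..t, D.slowFlow (t - s)
        (S.spY.ι (S.g ((w s).1, (w s).2.1 + (w s).2.2))) :=
    h.slow_eq _ hw t ht
  rw [← h2', ← h3', ← map_add, S.spY.isGenerator.1.eq_iff, S.spY.isGenerator.1.eq_iff]

theorem exists_slowOrbit_bound (hη : η ≤ βS) (hMB : 0 ≤ MB) {y₀ : Y₁} (hy : D.IsSlow y₀) :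
    ∃ q : ℝ → Y₁, ContinuousOn q (Iic 0) ∧
      (∀ t ≤ 0, S.spY.ι₁ (q t) = D.slowFlow t (S.spY.ι₁ y₀)) ∧
      ∀ t ≤ 0, ‖q t‖ ≤ MB * ‖y₀‖ * Real.exp (η * t) := by
  obtain ⟨q, hqc, hq⟩ := D.exists_slowOrbit hy
  refine ⟨q, hqc, fun t ht => (hq t ht).1, fun t ht => (hq t ht).2.trans ?_⟩
  have : Real.exp (βS * t) ≤ Real.exp (η * t) :=
    Real.exp_le_exp.2 (mul_le_mul_of_nonpos_right hη ht)
  calc _ ≤ MB * Real.exp (η * t) * ‖y₀‖ := by gcongr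
    _ = _ := by ring

theorem existsUnique [CompleteSpace X₁] [CompleteSpace Y₁] (h : IsLyapunovPerron S hε E D η L Φ)
    (hη : η ≤ βS) (hMB : 0 ≤ MB) {y₀ : Y₁} (hy : D.IsSlow y₀) :
    ∃ w ∈ weightedSpace X₁ D η, IsFixedPoint S E D y₀ w ∧
      ∀ w' ∈ weightedSpace X₁ D η, IsFixedPoint S E D y₀ w' → EqOn w' w (Iic 0) := by
  obtain ⟨q, hqc, hq, hqb⟩ := exists_slowOrbit_bound hη hMB hy
  have hqs : ∀ t ≤ 0, D.IsSlow (q t) := fun t ht =>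
    D.isSlow_iff.2 (by rw [hq t ht, D.P_slowFlow])
  obtain ⟨x, hxc, ⟨K, hK⟩, hx⟩ := h.lipschitz.exists_solution h.lt_one
    (p := fun t => SumState.mk 0 0 (q t)) (R := MB * ‖y₀‖)
    (SumState.continuous_mk.comp_continuousOn
      (continuousOn_const.prodMk (continuousOn_const.prodMk hqc)))
    (fun t ht => by simpa [SumState.norm_mk] using hqb t ht)
  have hadm : Admissible η x := .of_continuousOn hxc hK
  set w : ℝ → X₁ × Y₁ × Y₁ := fun t => ((x t).fst, (x t).snd.fst, (x t).snd.snd) with hw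
  have hwx : sumCurve w = x := rfl
  have hcomp : ∀ t ≤ 0, (x t).fst = (Φ x t).fst ∧ (x t).snd.fst = (Φ x t).snd.fst ∧
      (x t).snd.snd = q t + (Φ x t).snd.snd := fun t ht => SumState.eq_mk_add_iff.1 (hx t ht)
  refine ⟨w, ⟨?_, fun t ht => ⟨?_, ?_⟩, K, fun t ht => ?_⟩, ?_, fun w' hw' hfix t ht => ?_⟩
  · have hfst : Continuous fun y : SumState X₁ Y₁ => y.fst := WithLp.continuous_fst 1 _ _
    have hsnd : Continuous fun y : SumState X₁ Y₁ => y.snd := WithLp.continuous_snd 1 _ _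
    exact (hfst.prodMk (((WithLp.continuous_fst 1 _ _).comp hsnd).prodMk
      ((WithLp.continuous_snd 1 _ _).comp hsnd))).comp_continuousOn hxc
  · change D.IsFast (x t).snd.fst
    rw [(hcomp t ht).2.1]
    exact h.isFast _ hadm t
  · change D.IsSlow (x t).snd.snd
    rw [(hcomp t ht).2.2, D.isSlow_iff, map_add, map_add, D.isSlow_iff.1 (hqs t ht),
      D.isSlow_iff.1 (h.isSlow _ hadm t)]
  · have h1 := mul_le_mul_of_nonneg_left (hK t ht) (Real.exp_pos (-η * t)).le
    rw [mul_left_comm, ← Real.exp_add, neg_mul, neg_add_cancel, Real.exp_zero, mul_one,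
      SumState.norm_eq] at h1
    rwa [neg_mul]
  · exact (h.isFixedPoint_iff (hwx ▸ hadm) hq).2 hx
  · obtain ⟨hc', K', hK'⟩ := admissible_of_mem_weightedSpace hw'
    have hadm' : Admissible η (sumCurve w') := .of_continuousOn hc' hK'
    have h1 := h.lipschitz.norm_sub_le h.lt_one hadm' hadm
      ((h.isFixedPoint_iff hadm' hq).1 hfix) hx (R := 0) (fun s _ => by simp) ht
    rw [zero_div, zero_mul, norm_le_zero_iff, sub_eq_zero] at h1
    obtain ⟨e1, e2, e3⟩ := SumState.mk_inj (h1.trans (SumState.mk_eta (x t)).symm)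
    exact Prod.ext e1 (Prod.ext e2 e3)

theorem slowMap_spec [CompleteSpace X₁] [CompleteSpace Y₁] (h : IsLyapunovPerron S hε E D η L Φ)
    (hη : η ≤ βS) (hMB : 0 ≤ MB) {y₀ : Y₁} (hy : D.IsSlow y₀) :
    ∃ w ∈ weightedSpace X₁ D η, IsFixedPoint S E D y₀ w ∧
      slowMap S E D η y₀ = ((w 0).1, (w 0).2.1) := by
  obtain ⟨w, hw, hfix, -⟩ := h.existsUnique hη hMB hy
  have := Classical.epsilon_spec (p := fun w : ℝ → X₁ × Y₁ × Y₁ =>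
    w ∈ weightedSpace X₁ D η ∧ IsFixedPoint S E D y₀ w) ⟨w, hw, hfix⟩
  exact ⟨_, this.1, this.2, rfl⟩

end IsLyapunovPerron

end

/-- The curve `x₀` on `(-∞, 0]` followed by `x` on `(0, t]`, shifted to `(-∞, 0]`. -/
noncomputable def concat {E : Type*} (x₀ x : ℝ → E) (t s : ℝ) : E :=
  if s ≤ -t then x₀ (s + t) else x (s + t)

theorem concat_of_le {E : Type*} {x₀ x : ℝ → E} {t s : ℝ} (h : s ≤ -t) :
    concat x₀ x t s = x₀ (s + t) := if_pos h

theorem concat_of_lt {E : Type*} {x₀ x : ℝ → E} {t s : ℝ} (h : -t < s) :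
    concat x₀ x t s = x (s + t) := if_neg (not_le.2 h)

theorem admissible_concat {E : Type*} [NormedAddCommGroup E] {x₀ x : ℝ → E} {t η K : ℝ}
    (hη : η ≤ 0) (hc₀ : ContinuousOn x₀ (Iic 0))
    (hK : ∀ s ≤ 0, ‖x₀ s‖ ≤ K * Real.exp (η * s)) (hc : ContinuousOn x (Icc 0 t)) :
    Admissible η (concat x₀ x t) := by
  obtain ⟨B, hB⟩ := isCompact_Icc.exists_bound_of_continuousOn hc
  have hK0 : 0 ≤ K := by simpa using (norm_nonneg _).trans (hK 0 le_rfl)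
  refine ⟨⟨-t, ?_⟩, K * Real.exp (η * t) + |B|, fun s hs => ?_⟩
  · rintro s ⟨hs0, hst⟩
    rcases lt_or_gt_of_ne (show s ≠ -t from hst) with hlt | hgt
    · have h1 : ContinuousOn (fun s => x₀ (s + t)) (Iio (-t)) :=
        hc₀.comp (f := fun s => s + t) (by fun_prop) fun r (hr : r < -t) =>
          mem_Iic.2 (by linarith)
      refine ((h1.continuousAt (Iio_mem_nhds hlt)).congr ?_).continuousWithinAt
      filter_upwards [Iio_mem_nhds hlt] with r hr
      rw [concat_of_le (le_of_lt hr)]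
    · have h1 : ContinuousOn (fun s => x (s + t)) (Icc (-t) 0) :=
        hc.comp (f := fun s => s + t) (by fun_prop) fun r hr =>
          ⟨by linarith [hr.1], by linarith [hr.2]⟩
      have hU : Ioi (-t) ∈ 𝓝[Iic 0 \ {-t}] s := mem_nhdsWithin_of_mem_nhds (Ioi_mem_nhds hgt)
      have h2 : ContinuousWithinAt (fun s => x (s + t)) (Iic 0 \ {-t}) s :=
        (h1 s ⟨hgt.le, hs0⟩).mono_of_mem_nhdsWithin (by
          filter_upwards [hU, self_mem_nhdsWithin] with r h1 h2 using ⟨le_of_lt h1, h2.1⟩)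
      refine h2.congr_of_eventuallyEq ?_ (concat_of_lt hgt)
      filter_upwards [hU] with r hr using concat_of_lt hr
  · rw [add_mul]
    rcases le_or_gt s (-t) with hle | hgt
    · rw [concat_of_le hle]
      refine le_add_of_le_of_nonneg ((hK _ (by linarith)).trans (le_of_eq ?_)) (by positivity)
      rw [mul_assoc, ← Real.exp_add]
      ring_nf
    · rw [concat_of_lt hgt]
      refine le_add_of_nonneg_of_le (by positivity) ?_
      have h1 : 1 ≤ Real.exp (η * s) := Real.one_le_exp (mul_nonneg_of_nonpos_of_nonpos hη hs)
      calc ‖x (s + t)‖ ≤ B := hB _ ⟨by linarith, by linarith⟩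
        _ ≤ |B| * 1 := by rw [mul_one]; exact le_abs_self B
        _ ≤ _ := by gcongr

section

variable {X X₁ Xγ Y Y₁ Yδ : Type*}
  [NormedAddCommGroup X] [NormedSpace ℝ X] [NormedAddCommGroup X₁] [NormedSpace ℝ X₁]
  [NormedAddCommGroup Xγ] [NormedSpace ℝ Xγ]
  [NormedAddCommGroup Y] [NormedSpace ℝ Y] [NormedAddCommGroup Y₁] [NormedSpace ℝ Y₁]
  [NormedAddCommGroup Yδ] [NormedSpace ℝ Yδ]
  {S : System X X₁ Xγ Y Y₁ Yδ}

theorem System.continuous_fMod (S : System X X₁ Xγ Y Y₁ Yδ) : Continuous S.fMod :=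
  S.f_contDiff.continuous.sub (S.Dxf.continuous.comp continuous_fst)

theorem System.continuous_forceX (S : System X X₁ Xγ Y Y₁ Yδ) (ε : ℝ) :
    Continuous (S.forceX ε) :=
  (S.spX.ι.continuous.comp (S.continuous_fMod.comp SumState.continuous_fst_sum)).const_smul _

theorem System.continuous_gSum (S : System X X₁ Xγ Y Y₁ Yδ) : Continuous S.gSum :=
  S.g_contDiff.continuous.comp SumState.continuous_fst_sum

namespace IsStrictSolution

variable {ε γ μ M C : ℝ} {δ βF βS CB MB : ℝ}
  {D : Splitting S.spY δ βF βS CB MB} {T : ℝ} {u : ℝ → X₁} {vF vS : ℝ → Y₁}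

theorem continuousOn (h : IsStrictSolution S ε D T u vF vS) :
    ContinuousOn (fun q => SumState.mk (u q) (vF q) (vS q)) (Icc 0 T) :=
  SumState.continuous_mk.comp_continuousOn
    (h.continuousOn_u.prodMk (h.continuousOn_vF.prodMk h.continuousOn_vS))

theorem mild_u [CompleteSpace X] (h : IsStrictSolution S ε D T u vF vS) (hε : 0 < ε)
    (E : ModifiedSemigroup S ε γ μ M C) {r : ℝ} (hr : r ∈ Icc 0 T) :
    S.spX.ι₁ (u r) = (E.semigroup.rescale ε⁻¹ (inv_pos.2 hε)).op r (S.spX.ι₁ (u 0)) +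
      ∫ q in (0 : ℝ)..r, (E.semigroup.rescale ε⁻¹ (inv_pos.2 hε)).op (r - q)
        (S.forceX ε (SumState.mk (u q) (vF q) (vS q))) := by
  refine (E.isGenerator.rescale (inv_pos.2 hε)).variation_of_constants
    ((S.continuous_forceX ε).comp_continuousOn h.continuousOn) (fun t ht => ?_) hr
  refine (h.deriv_u t ht).congr_deriv ?_
  change _ = ε⁻¹ • (ε • S.spX.gen (u t) + S.spX.ι (S.Dxf (u t))) +
    ε⁻¹ • S.spX.ι (S.f (u t, vF t + vS t) - S.Dxf (u t))
  rw [smul_add, inv_smul_smul₀ hε.ne', map_sub, smul_sub]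
  abel

theorem mild_vF [CompleteSpace Y] (h : IsStrictSolution S ε D T u vF vS) {r : ℝ}
    (hr : r ∈ Icc 0 T) :
    S.spY.ι₁ (vF r) = S.spY.semigroup.op r (S.spY.ι₁ (vF 0)) +
      ∫ q in (0 : ℝ)..r, S.spY.semigroup.op (r - q)
        (S.spY.ι (D.prF (S.gSum (SumState.mk (u q) (vF q) (vS q))))) :=
  S.spY.isGenerator.variation_of_constants
    ((S.spY.ι.comp D.prF).continuous.comp_continuousOn
      (S.continuous_gSum.comp_continuousOn h.continuousOn)) h.deriv_vF hr

theorem mild_vS [CompleteSpace Y] (h : IsStrictSolution S ε D T u vF vS) {r : ℝ}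
    (hr : r ∈ Icc 0 T) :
    S.spY.ι₁ (vS r) = D.slowFlow r (S.spY.ι₁ (vS 0)) +
      ∫ q in (0 : ℝ)..r, D.slowFlow (r - q)
        (S.spY.ι (S.gSum (SumState.mk (u q) (vF q) (vS q)))) := by
  have key := S.spY.isGenerator.variation_of_constants
    ((D.P.comp S.spY.ι).continuous.comp_continuousOn
      (S.continuous_gSum.comp_continuousOn h.continuousOn)) h.deriv_vS hr
  rw [key, D.slowFlow_of_nonneg hr.1, D.isSlow_iff.1 (h.slow 0 ⟨le_rfl, hr.1.trans hr.2⟩)]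
  congr 1
  refine intervalIntegral.integral_congr fun q hq => ?_
  rw [uIcc_of_le hr.1] at hq
  exact (D.slowFlow_of_nonneg (sub_nonneg.2 hq.2) _).symm

end IsStrictSolution

namespace IsLyapunovPerron

variable {ε γ μ M C : ℝ} {hε : 0 < ε}
  {E : ModifiedSemigroup S ε γ μ M C} {δ βF βS CB MB : ℝ}
  {D : Splitting S.spY δ βF βS CB MB} {η L : ℝ}
  {Φ : (ℝ → SumState X₁ Y₁) → ℝ → SumState X₁ Y₁}
  [CompleteSpace X] [CompleteSpace Y]

/-- A solution, preceded by the trajectory in the slow manifold through its initial slow part,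
solves the Lyapunov–Perron equation with an inhomogeneity that comes from the jump. -/
theorem concat_eq (h : IsLyapunovPerron S hε E D η L Φ) {T : ℝ} {u : ℝ → X₁} {vF vS : ℝ → Y₁}
    (hsol : IsStrictSolution S ε D T u vF vS) {t : ℝ} (ht : t ∈ Icc 0 T)
    {w : ℝ → X₁ × Y₁ × Y₁} (hw : ContinuousOn (sumCurve w) (Iic 0))
    (hfix : IsFixedPoint S E D (vS 0) w) {q : ℝ → Y₁}
    (hq : ∀ s ≤ 0, S.spY.ι₁ (q s) = D.slowFlow s (S.spY.ι₁ (vS t)))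
    {z : ℝ → SumState X₁ Y₁}
    (hz : z = concat (sumCurve w) (fun r => SumState.mk (u r) (vF r) (vS r)) t)
    (hadm : Admissible η z) {s : ℝ} (hs : s ≤ 0) :
    z s = SumState.mk
      (if s ≤ -t then 0 else
        (E.isGenerator.rescale (inv_pos.2 hε)).domainOp (s + t) (u 0 - (w 0).1))
      (if s ≤ -t then 0 else S.spY.isGenerator.domainOp (s + t) (vF 0 - (w 0).2.1)) (q s) +
      Φ z s := by
  have hnt : -t ≤ 0 := neg_nonpos.2 ht.1
  have hz₀ : ∀ r ≤ -t, z r = sumCurve w (r + t) := fun r hr => by rw [hz, concat_of_le hr]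
  have hz₁ : ∀ r ∈ Ioc (-t) 0, z r = SumState.mk (u (r + t)) (vF (r + t)) (vS (r + t)) :=
    fun r hr => by rw [hz, concat_of_lt hr.1]
  have hslow := hsol.mild_vS ht
  have hΓ : ContinuousOn (fun r => S.spY.ι (S.gSum (SumState.mk (u r) (vF r) (vS r)))) (Icc 0 t) :=
    (S.spY.ι.continuous.comp_continuousOn (S.continuous_gSum.comp_continuousOn
      hsol.continuousOn)).mono (Icc_subset_Icc_right ht.2)
  have hG₀ : ContinuousOn (fun r => S.spY.ι (S.gSum (sumCurve w r))) (Iic 0) :=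
    S.spY.ι.continuous.comp_continuousOn (S.continuous_gSum.comp_continuousOn hw)
  have hf1 := fun r hr => (hfix r hr).1
  simp only [← S.rescale_forceX hε E] at hf1
  have hf2 : ∀ r ≤ 0, S.spY.ι₁ (w r).2.1 = ∫ q in Iic r, S.spY.semigroup.op (r - q)
      (S.spY.ι (D.prF (S.gSum (sumCurve w q)))) := fun r hr => (hfix r hr).2.1
  have hf3 : ∀ r ≤ 0, S.spY.ι₁ (w r).2.2 = D.slowFlow r (S.spY.ι₁ (vS 0)) +
      ∫ q in (0 : ℝ)..r, D.slowFlow (r - q) (S.spY.ι (S.gSum (sumCurve w q))) :=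
    fun r hr => (hfix r hr).2.2
  rcases le_or_gt s (-t) with hle | hgt
  · have hst : s + t ≤ 0 := by linarith
    rw [if_pos hle, if_pos hle, hz₀ s hle, sumCurve, SumState.eq_mk_add_iff]
    refine ⟨S.spX.isGenerator.1 ?_, S.spY.isGenerator.1 ?_, S.spY.isGenerator.1 ?_⟩
    · rw [h.fst_eq _ hadm s hs, hf1 _ hst, ← setIntegral_Iic_add_right]
      refine setIntegral_congr_fun measurableSet_Iic fun r hr => ?_
      rw [hz₀ r (le_trans hr hle), add_sub_add_right_eq_sub]
    · rw [h.fast_eq _ hadm s hs, hf2 _ hst, ← setIntegral_Iic_add_right]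
      refine setIntegral_congr_fun measurableSet_Iic fun r hr => ?_
      rw [hz₀ r (le_trans hr hle), add_sub_add_right_eq_sub]
    · rw [map_add, h.slow_eq _ hadm s hs, hf3 _ hst, hq s hs]
      exact (D.slow_concat_left ht.1 hle hG₀ hΓ (fun r hr => by rw [hz₀ r hr])
        (fun r hr => by rw [hz₁ r hr]) hslow).symm
  · have hst : s + t ∈ Icc 0 T := ⟨by linarith, by linarith [ht.2]⟩
    rw [if_neg (not_le.2 hgt), if_neg (not_le.2 hgt), hz₁ s ⟨hgt, hs⟩,
      ← SumState.mk_eta (Φ z s), SumState.mk_add]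
    congr 1
    · refine S.spX.isGenerator.1 ?_
      rw [map_add, (E.isGenerator.rescale _).ι_domainOp hst.1, map_sub, h.fst_eq _ hadm s hs,
        hsol.mild_u hε E hst]
      exact C0Semigroup.concat_eq _ ⟨hgt.le, hs⟩ (fun r hr => by rw [hz₀ r hr])
        (fun r hr => by rw [hz₁ r hr]) (h.integrable_fst _ hadm _ hnt)
        (h.integrable_fst _ hadm _ hs) (hf1 0 le_rfl)
    · refine S.spY.isGenerator.1 ?_
      rw [map_add, S.spY.isGenerator.ι_domainOp hst.1, map_sub, h.fast_eq _ hadm s hs,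
        hsol.mild_vF hst]
      exact C0Semigroup.concat_eq _ ⟨hgt.le, hs⟩ (fun r hr => by rw [hz₀ r hr])
        (fun r hr => by rw [hz₁ r hr]) (h.integrable_fast _ hadm _ hnt)
        (h.integrable_fast _ hadm _ hs) (hf2 0 le_rfl)
    · refine S.spY.isGenerator.1 ?_
      rw [map_add, h.slow_eq _ hadm s hs, hsol.mild_vS hst, hq s hs]
      exact (D.slow_concat_right ⟨hgt.le, hs⟩ hΓ (fun r hr => by rw [hz₁ r hr]) hslow).symm

theorem exists_attraction [CompleteSpace X₁] [CompleteSpace Y₁]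
    (h : IsLyapunovPerron S hε E D η L Φ) (hF : βF ≤ η) (hS : η ≤ βS) (hη0 : η < 0)
    (hμ : μ * ε⁻¹ ≤ η) (hδ : δ ≤ 1) (hM : 0 ≤ M) (hCB : 0 ≤ CB) (hMB : 0 ≤ MB) :
    ∃ C c : ℝ, 0 < C ∧ 0 < c ∧
      ∀ (T : ℝ) (u : ℝ → X₁) (vF vS : ℝ → Y₁), IsStrictSolution S ε D T u vF vS →
        ∀ t ∈ Icc 0 T,
          ‖u t - (slowMap S E D η (vS t)).1‖ + ‖vF t - (slowMap S E D η (vS t)).2‖ ≤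
            C * Real.exp (-c * t) * (‖u 0 - (slowMap S E D η (vS 0)).1‖ +
              ‖vF 0 - (slowMap S E D η (vS 0)).2‖) := by
  obtain ⟨cF, hcF, hFb⟩ := D.exists_fast_bound hδ hCB hF hη0.le
  have hUb : ∀ (x : X₁) r, 0 ≤ r → ‖(E.isGenerator.rescale (inv_pos.2 hε)).domainOp r x‖ ≤
      M * Real.exp (η * r) * ‖x‖ := fun x r hr => by
    obtain ⟨y, hy, hb⟩ := E.bound_one (ε⁻¹ * r) (mul_nonneg (inv_pos.2 hε).le hr) x
    have : (E.isGenerator.rescale (inv_pos.2 hε)).domainOp r x = y :=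
      S.spX.isGenerator.1 (by rw [(E.isGenerator.rescale _).ι_domainOp hr, hy]; rfl)
    rw [this]
    refine hb.trans ?_
    rw [← mul_assoc]
    gcongr
  have hL1 : 0 < 1 - L := sub_pos.2 h.lt_one
  set c₀ := M + cF + 1 with hc₀
  have hc₀1 : 1 ≤ c₀ := by linarith
  refine ⟨c₀ / (1 - L), -η, div_pos (by linarith) hL1, neg_pos.2 hη0,
    fun T u vF vS hsol t ht => ?_⟩
  obtain ⟨w, hw, hfix, hw0⟩ := h.slowMap_spec hS hMB (hsol.slow 0 ⟨le_rfl, ht.1.trans ht.2⟩)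
  obtain ⟨wt, hwt, hfixt, hwt0⟩ := h.slowMap_spec hS hMB (hsol.slow t ht)
  rw [neg_neg]
  set d := ‖u 0 - (slowMap S E D η (vS 0)).1‖ + ‖vF 0 - (slowMap S E D η (vS 0)).2‖ with hd
  rcases ht.1.eq_or_lt with rfl | ht0
  · rw [mul_zero, Real.exp_zero, mul_one]
    refine le_mul_of_one_le_left (by positivity) ?_
    rw [le_div_iff₀ hL1]
    linarith [h.lipschitz.nonneg]
  obtain ⟨q, hqc, hq, -⟩ := exists_slowOrbit_bound hS hMB (hsol.slow t ht)
  obtain ⟨hwc, K, hK⟩ := admissible_of_mem_weightedSpace hw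
  obtain ⟨hwtc, Kt, hKt⟩ := admissible_of_mem_weightedSpace hwt
  have hadmt : Admissible η (sumCurve wt) := .of_continuousOn hwtc hKt
  have hadm := admissible_concat (t := t) hη0.le hwc hK
    (hsol.continuousOn.mono (Icc_subset_Icc_right ht.2))
  have key := h.lipschitz.norm_sub_le h.lt_one hadm hadmt (R := c₀ * Real.exp (η * t) * d)
    (fun s hs => h.concat_eq hsol ht hwc hfix hq rfl hadm hs)
    ((h.isFixedPoint_iff hadmt hq).1 hfixt) (fun s hs => ?_) (le_refl (0 : ℝ))
  · rw [concat_of_lt (neg_lt_zero.2 ht0), zero_add, mul_zero, Real.exp_zero, mul_one, sumCurve,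
      SumState.mk_sub, SumState.norm_mk] at key
    rw [hwt0]
    calc _ ≤ _ := le_add_of_nonneg_right (norm_nonneg _)
      _ ≤ _ := key
      _ = _ := by ring
  · rw [SumState.mk_sub, sub_self, sub_zero, sub_zero, SumState.norm_mk, norm_zero, add_zero]
    rcases le_or_gt s (-t) with hle | hgt
    · rw [if_pos hle, if_pos hle, norm_zero, norm_zero, add_zero]
      positivity
    · rw [if_neg (not_le.2 hgt), if_neg (not_le.2 hgt)]
      have hst : 0 ≤ s + t := by linarith
      have hfast : D.IsFast (vF 0 - (w 0).2.1) := by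
        have h1 : D.P (S.spY.ι₁ (vF 0)) = 0 := hsol.fast 0 ⟨le_rfl, ht.1.trans ht.2⟩
        have h2 : D.P (S.spY.ι₁ (w 0).2.1) = 0 := (hw.2.1 0 le_rfl).1
        rw [Splitting.IsFast, map_sub, map_sub, h1, h2, sub_zero]
      have e : Real.exp (η * t) * Real.exp (η * s) = Real.exp (η * (s + t)) := by
        rw [← Real.exp_add]; ring_nf
      calc _ ≤ M * Real.exp (η * (s + t)) * ‖u 0 - (w 0).1‖ +
            cF * Real.exp (η * (s + t)) * ‖vF 0 - (w 0).2.1‖ :=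
            add_le_add (hUb _ _ hst) (hFb _ hfast _ hst)
        _ ≤ c₀ * Real.exp (η * (s + t)) * ‖u 0 - (w 0).1‖ +
            c₀ * Real.exp (η * (s + t)) * ‖vF 0 - (w 0).2.1‖ := by
            gcongr <;> linarith
        _ = c₀ * (Real.exp (η * t) * Real.exp (η * s)) * d := by rw [e, hd, hw0]; ring
        _ = _ := by ring

end IsLyapunovPerron

end

end FastReaction

theorem mainTheorem4
    {X X₁ Xγ Y Y₁ Yδ : Type*}
    [NormedAddCommGroup X] [NormedSpace ℝ X] [CompleteSpace X]
    [NormedAddCommGroup X₁] [NormedSpace ℝ X₁] [CompleteSpace X₁]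
    [NormedAddCommGroup Xγ] [NormedSpace ℝ Xγ] [CompleteSpace Xγ]
    [NormedAddCommGroup Y] [NormedSpace ℝ Y] [CompleteSpace Y]
    [NormedAddCommGroup Y₁] [NormedSpace ℝ Y₁] [CompleteSpace Y₁]
    [NormedAddCommGroup Yδ] [NormedSpace ℝ Yδ] [CompleteSpace Yδ]
    (S : FastReaction.System X X₁ Xγ Y Y₁ Yδ)
    (γ δ : ℝ) (hγ : γ ∈ Set.Ioc (0 : ℝ) 1) (hδ : δ ∈ Set.Ioc (0 : ℝ) 1)
    (ωA lam₀ MA CA MB CB Lf Lg NF NS : ℝ)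
    (hlam : lam₀ < 0) (hMA : 0 < MA) (hCA : 0 < CA) (hMB : 0 < MB) (hCB : 0 < CB)
    (hLf : 0 ≤ Lf) (hLg : 0 ≤ Lg) (hNF : 0 ≤ NF) (hN : NF < NS)
    -- Lipschitz continuity of the modified `f` and of `g`
    (hf : ∀ (x₁ x₂ : X₁) (y₁ y₂ : Y₁),
      ‖S.fMod (x₁, y₁) - S.fMod (x₂, y₂)‖ ≤ Lf * (‖x₁ - x₂‖ + ‖y₁ - y₂‖))
    (hg : ∀ (x₁ x₂ : X₁) (y₁ y₂ : Y₁),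
      ‖S.g (x₁, y₁) - S.g (x₂, y₂)‖ ≤ Lg * (‖x₁ - x₂‖ + ‖y₁ - y₂‖))
    -- the two small parameters
    (ε ζ : ℝ) (hε : 0 < ε) (hζ : 0 < ζ) (hεζ : ε * ζ⁻¹ < 1)
    (hμ : ε * ωA + lam₀ < 0)
    -- the semigroup generated by the modified operator, and its bounds
    (E : FastReaction.ModifiedSemigroup S ε γ (ε * ωA + lam₀) MA CA)
    -- the splitting of `Y`, with a nontrivial slow part
    (D : FastReaction.Splitting S.spY δ (NF + ζ⁻¹ * (ε * ωA + lam₀))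
      (NS + ζ⁻¹ * (ε * ωA + lam₀)) CB MB)
    (hD : D.P ≠ 0)
    -- the spectral gap condition
    (hL : FastReaction.gapConst ε ζ (ε * ωA + lam₀) γ δ Lf Lg CA CB MB NF NS ‖D.prF‖ ‖D.Q‖ < 1)
    (η : ℝ) (hη : η = ζ⁻¹ * (ε * ωA + lam₀) + (NS + NF) / 2) :
    -- the slow manifold is well defined ...
    (∀ y₀ : Y₁, D.IsSlow y₀ →
      ∃ w ∈ FastReaction.weightedSpace X₁ D η, FastReaction.IsFixedPoint S E D y₀ w ∧
        ∀ w' ∈ FastReaction.weightedSpace X₁ D η, FastReaction.IsFixedPoint S E D y₀ w' →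
          Set.EqOn w' w (Set.Iic 0)) ∧
    -- ... and attracts all trajectories exponentially
    ∃ C c : ℝ, 0 < C ∧ 0 < c ∧
      ∀ (T : ℝ) (u : ℝ → X₁) (vF vS : ℝ → Y₁),
        FastReaction.IsStrictSolution S ε D T u vF vS →
        ∀ t ∈ Set.Icc 0 T,
          ‖u t - (FastReaction.slowMap S E D η (vS t)).1‖
              + ‖vF t - (FastReaction.slowMap S E D η (vS t)).2‖
            ≤ C * Real.exp (-c * t) *
              (‖u 0 - (FastReaction.slowMap S E D η (vS 0)).1‖
                + ‖vF 0 - (FastReaction.slowMap S E D η (vS 0)).2‖) := by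
  have hNSF : 0 < NS - NF := sub_pos.2 hN
  obtain ⟨L, Φ, h⟩ := FastReaction.exists_isLyapunovPerron S hγ hδ hCA hMB hCB hLf hLg hNF hN hf hg
    hε hεζ hμ E D hL hη
  have hF : NF + ζ⁻¹ * (ε * ωA + lam₀) ≤ η := by rw [hη]; linarith
  have hS : η ≤ NS + ζ⁻¹ * (ε * ωA + lam₀) := by rw [hη]; linarith
  have hη0 : η < 0 := hS.trans_lt (D.slowRate_neg hD hMB.le)
  have hμη : (ε * ωA + lam₀) * ε⁻¹ ≤ η := by
    have h1 : ζ⁻¹ ≤ ε⁻¹ := by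
      rw [le_inv_comm₀ (inv_pos.2 hζ) hε]
      rw [← div_eq_mul_inv, div_lt_one hζ] at hεζ
      rw [inv_inv]
      exact hεζ.le
    have h2 := mul_le_mul_of_nonpos_right h1 hμ.le
    rw [hη]
    linarith
  exact ⟨fun y₀ hy => h.existsUnique hS hMB.le hy,
    h.exists_attraction hF hS hη0 hμη hδ.2 hMA.le hCB.le hMB.le⟩
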